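/- Let $(S_n)_{n\ge 0}$ be a random walk on $\mathbb{R}$ with $S_0=0$ and i.i.d. steps satisfying $\mathbf{E}[S_1]=0$ and $\sigma^2=\mathbf{E}[S_1^2]\in(0,\infty)$. Let $U^-$ be the renewal measure of its weak descending ladder heights, i.e. $U^-(B)$ is the expected number of weak descending ladder epochs (the times $n\ge 0$ with $S_n\le S_k$ for all $0\le k<n$, including $n=0$) for which $-S_n\in B$. Put $R(0):=1$ and $R(x):=U^-([0,x))$ for $x>0$. Let $(\zeta_n)_{n\ge 0}$ be the random walk conditioned to stay positive, started from $\zeta_0=0$; that is, for all $n\ge 0$ and all measurable $g:\mathbb{R}^{n+1}\to[0,\infty]$, $$\mathbf{E}\big[g(\zeta_0,\dots,\zeta_n)\big]=\frac{1}{R(0)}\,\mathbf{E}\Big[g(S_0,\dots,S_n)\,R(S_n)\,\mathbf{1}_{\{S_k>0\text{ for all }1\le k\le n\}}\Big].$$ Let $F:[0,\infty)\to[0,\infty)$ be non-increasing. Then $$\int_0^\infty F(y)\,y\,\mathrm{d}y=\infty\quad\Longleftrightarrow\quad \sum_{n\ge 0}F(\zeta_n)=\infty\ \text{ almost surely.}$$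 -/

import Mathlib

open MeasureTheory ProbabilityTheory Set
open scoped ENNReal

noncomputable section

namespace ConditionedWalk

/-- The random walk started at `0` with steps `X 0, X 1, …`: `S 0 = 0`, `S n = X 0 + ⋯ + X (n - 1)`. -/
def walk {Ω : Type*} (X : ℕ → Ω → ℝ) (n : ℕ) (ω : Ω) : ℝ :=
  ∑ i ∈ Finset.range n, X i ω

/-- The event that `n` is a weak descending ladder epoch of the process `S`: `S n` is at most every
earlier value. The epoch `0` is always one; the following ones are the successive times at which
the path is at or below its value at the preceding ladder epoch. -/
def weakDescLadderEvent {Ω : Type*} (S : ℕ → Ω → ℝ) (n : ℕ) : Set Ω :=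
  {ω | ∀ k < n, S n ω ≤ S k ω}

/-- The renewal measure of the weak descending ladder height process of `S`, for a process `S`
with `S 0 = 0`: the mass of `B` is the expected number of weak descending ladder epochs `n`
(including `n = 0`) whose ladder height `- S n` lies in `B`. -/
def weakDescRenewalMeasure {Ω : Type*} [MeasurableSpace Ω] (P : Measure Ω) (S : ℕ → Ω → ℝ) :
    Measure ℝ :=
  Measure.sum fun n => (P.restrict (weakDescLadderEvent S n)).map (fun ω => -S n ω)

/-- The function `R`: `R 0 = 1` and, for `x > 0`, `R x` is the mass that the renewal measure of the
weak descending ladder heights gives to `[0, x)`. Its values at `x < 0` are never used. -/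
def renewalFn {Ω : Type*} [MeasurableSpace Ω] (P : Measure Ω) (S : ℕ → Ω → ℝ) (x : ℝ) : ℝ≥0∞ :=
  if 0 < x then weakDescRenewalMeasure P S (Ico 0 x) else 1

/-- `ζ` (on the probability space `(Ω', P')`) is a version of the walk `S` (on `(Ω, P)`, with
`S 0 = 0`) conditioned to stay positive and started at `0`. That is, its law is the Doob transform
by `R` of the walk killed on entering `(-∞, 0]` at a time `≥ 1`: for each `n` and each measurable
`g ≥ 0`,
`E[g(ζ 0, …, ζ n)] = R(0)⁻¹ * E[g(S 0, …, S n) R(S n) ; S 1 > 0, …, S n > 0]`. -/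
structure IsConditionedToStayPositive {Ω Ω' : Type*} [MeasurableSpace Ω] [MeasurableSpace Ω']
    (P : Measure Ω) (S : ℕ → Ω → ℝ) (P' : Measure Ω') (ζ : ℕ → Ω' → ℝ) : Prop where
  measurable : ∀ n, Measurable (ζ n)
  law : ∀ (n : ℕ) (g : (Fin (n + 1) → ℝ) → ℝ≥0∞), Measurable g →
    ∫⁻ ω', g (fun i => ζ i ω') ∂P' =
      (renewalFn P S 0)⁻¹ *
        ∫⁻ ω in {ω | ∀ k, 1 ≤ k → k ≤ n → 0 < S k ω},
          g (fun i => S i ω) * renewalFn P S (S n ω) ∂P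

end ConditionedWalk

end

/-! The conditioned walk is the Doob transform by `R` of the walk killed on `(-∞, 0]`, so the
expected value of `∑ φ(ζ_m)` from height `x` is `G(φR)(x) / R(x)`, where `G` is the Green operator
of the killed walk (`tsum_lintegral_eq`). Cutting a killed path at its last minimum writes `Gψ(x)`
as a sum over weak descending ladder epochs with total mass `R(x)`, each weighted by the potential
of `ψ` along an excursion strictly above that minimum (`killedGreen_eq`). Thus `Gψ(x) / R(x)` is an
average of such climbing potentials from points of `[0, x]`, and for `ψ = 1_{(-∞, t)}` the potential
from `z` is `V(t - z)` with `V = climbFn`.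

Both `R` and `V` grow linearly (`exists_linear_bounds`). The upper bounds hold because a band of
ladder heights is skipped by a big enough step, which has positive probability. For the lower
bounds, finite variance forces the mean exit time from `(-s, s)` to be at least `s² / σ²`, while the
last-minimum decomposition bounds it by `V(2s) R(s)`. It follows that the conditioned walk spends
expected time of order `t²` in `[t, Kt)`, uniformly over starting heights at most `t`
(`exists_greenBounds`). The mean of `∑ F(ζ_n)` is therefore governed by `∑ F(K^i) K^{2i}`, which
diverges exactly when the integral does.

If the integral is finite, the mean is finite and the sum cannot be almost surely infinite. If it
diverges, the upper Green bound, valid from every starting height, controls second moments by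
squared means; Paley–Zygmund then shows that, given any event of the past, the sum is infinite with
conditional probability at least a fixed `κ > 0` (`le_measure_tsum_eq_top`). Approximation by
cylinders upgrades this to probability one. -/

noncomputable section

/-! ### Random walk paths: time reversal and the Markov property. -/

namespace ConditionedWalk

/-- The steps `X 0, X 1, …` are measurable, independent and identically distributed. -/
structure IsIIDSteps {Ω : Type*} [MeasurableSpace Ω] (P : Measure Ω) (X : ℕ → Ω → ℝ) : Prop where
  measurable : ∀ n, Measurable (X n)
  indep : iIndepFun X P
  ident : ∀ n, IdentDistrib (X n) (X 0) P P

section Walk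

variable {Ω : Type*} {X : ℕ → Ω → ℝ}

@[simp] lemma walk_zero (ω : Ω) : walk X 0 ω = 0 := by simp [walk]

lemma walk_add (n j : ℕ) (ω : Ω) :
    walk X (n + j) ω = walk X n ω + walk (fun i => X (n + i)) j ω := by
  simp [walk, Finset.sum_range_add]

lemma walk_one (ω : Ω) : walk X 1 ω = X 0 ω := by simp [walk]

/-- Only the first `m` steps are reversed; fixing the later indices keeps the reindexing injective
on `ℕ`, as `map_precomp` requires. -/
lemma walk_reverse (m k : ℕ) (hk : k ≤ m) (ω : Ω) :
    walk (fun i => X (if i < m then m - 1 - i else i)) k ω = walk X m ω - walk X (m - k) ω := by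
  induction k with
  | zero => simp
  | succ k ih =>
    have h1 : walk (fun i => X (if i < m then m - 1 - i else i)) (k + 1) ω =
        walk (fun i => X (if i < m then m - 1 - i else i)) k ω + X (m - 1 - k) ω := by
      simp [walk, Finset.sum_range_succ, show k < m by omega]
    have h2 : walk X (m - k) ω = walk X (m - (k + 1)) ω + X (m - 1 - k) ω := by
      obtain ⟨j, rfl⟩ : ∃ j, m = j + (k + 1) := ⟨m - (k + 1), by omega⟩
      rw [show j + (k + 1) - k = j + 1 by omega, show j + (k + 1) - (k + 1) = j by omega,
        show j + (k + 1) - 1 - k = j by omega]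
      simp [walk, Finset.sum_range_succ]
    rw [h1, ih (by omega), h2]; ring

lemma measurable_walk_path [MeasurableSpace Ω] (hX : ∀ i, Measurable (X i)) :
    Measurable fun ω k => walk X k ω := by
  unfold walk
  fun_prop

lemma measurable_walk_stopped [MeasurableSpace Ω] (n : ℕ) (hX : ∀ i < n, Measurable (X i)) :
    Measurable fun ω k => walk X (min k n) ω := by
  refine measurable_pi_iff.2 fun k => Finset.measurable_fun_sum _ fun i hi => hX i ?_
  simp at hi
  omega

end Walk

namespace IsIIDSteps

variable {Ω : Type*} [MeasurableSpace Ω] {P : Measure Ω}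
  {X : ℕ → Ω → ℝ}

lemma measurable_walk (h : IsIIDSteps P X) (n : ℕ) : Measurable (walk X n) := by
  have := h.measurable
  unfold walk
  fun_prop

lemma measurable_path (h : IsIIDSteps P X) : Measurable fun ω k => walk X k ω :=
  measurable_pi_iff.2 h.measurable_walk

/-- The law of an i.i.d. sequence is unchanged by an injective reindexing. -/
lemma map_precomp (h : IsIIDSteps P X) {e : ℕ → ℕ} (he : Function.Injective e) :
    P.map (fun ω j => X (e j) ω) = P.map (fun ω j => X j ω) := by
  rw [(h.indep.precomp he).map_fun_eq_infinitePi_map (fun i => h.measurable _),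
    h.indep.map_fun_eq_infinitePi_map h.measurable]
  congr 1
  funext i
  rw [(h.ident (e i)).map_eq, (h.ident i).map_eq]

lemma lintegral_precomp (h : IsIIDSteps P X) {e : ℕ → ℕ} (he : Function.Injective e)
    {f : (ℕ → ℝ) → ℝ≥0∞} (hf : Measurable f) :
    ∫⁻ ω, f (fun k => walk (fun i => X (e i)) k ω) ∂P = ∫⁻ ω, f (fun k => walk X k ω) ∂P := by
  have hs : Measurable fun (x : ℕ → ℝ) (k : ℕ) => ∑ i ∈ Finset.range k, x i := by fun_prop
  have hX := h.measurable
  have h1 := lintegral_map (μ := P) (hf.comp hs) (g := fun ω j => X (e j) ω) (by fun_prop)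
  have h2 := lintegral_map (μ := P) (hf.comp hs) (g := fun ω j => X j ω) (by fun_prop)
  rw [h.map_precomp he] at h1
  exact h1.symm.trans h2

/-- Reversal of time. -/
lemma lintegral_reverse (h : IsIIDSteps P X) (m : ℕ) {f : (ℕ → ℝ) → ℝ≥0∞} (hf : Measurable f) :
    ∫⁻ ω, f (fun k => walk X m ω - walk X (m - k) ω) ∂P =
      ∫⁻ ω, f (fun k => walk X (min k m) ω) ∂P := by
  have he : Function.Injective fun i => if i < m then m - 1 - i else i := by
    intro i j hij
    simp only at hij
    split_ifs at hij <;> omega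
  have hr : Measurable fun (v : ℕ → ℝ) (k : ℕ) => v (min k m) := by fun_prop
  refine Eq.trans ?_ (h.lintegral_precomp he (hf.comp hr))
  refine lintegral_congr fun ω => ?_
  simp only [Function.comp]
  congr 1
  funext k
  rw [walk_reverse m _ (min_le_right k m)]
  rcases le_total k m with hk | hk
  · rw [min_eq_left hk]
  · rw [min_eq_right hk, Nat.sub_eq_zero_of_le hk, Nat.sub_self]

/-- The Markov property at the time `n`, the past being recorded by the stopped walk. -/
lemma lintegral_markov [IsProbabilityMeasure P] (h : IsIIDSteps P X) (n : ℕ)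
    {f : (ℕ → ℝ) → (ℕ → ℝ) → ℝ≥0∞}
    (hf : Measurable (Function.uncurry f)) :
    ∫⁻ ω, f (fun k => walk X (min k n) ω) (fun j => walk X (n + j) ω - walk X n ω) ∂P =
      ∫⁻ ω, ∫⁻ ω', f (fun k => walk X (min k n) ω) (fun j => walk X j ω') ∂P ∂P := by
  have hX := h.measurable
  have hw := h.measurable_walk
  set Y : Ω → ℕ → ℝ := fun ω k => walk X (min k n) ω with hYdef
  set Z : Ω → ℕ → ℝ := fun ω j => walk X (n + j) ω - walk X n ω with hZdef
  have hZ : Z = fun ω j => walk (fun i => X (n + i)) j ω := by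
    funext ω j
    simp [hZdef, walk_add]
  have hYm : Measurable Y := by fun_prop
  have hZm : Measurable Z := by fun_prop
  have hind : IndepFun Y Z P := by
    have hI := indep_iSup_of_disjoint (m := fun i => MeasurableSpace.comap (X i) inferInstance)
      (fun i => (hX i).comap_le) h.indep (S := Iio n) (T := Ici n)
      (by rw [Set.disjoint_left]; intro a ha hb; simp at ha hb; omega)
    refine indep_of_indep_of_le_left (indep_of_indep_of_le_right hI ?_) ?_
    · rw [← measurable_iff_comap_le, hZ]
      refine @measurable_walk_path _ _ (_) fun i => ?_
      exact Measurable.mono (comap_measurable (X (n + i)))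
        (le_iSup₂_of_le (n + i) (by simp) le_rfl) le_rfl
    · rw [← measurable_iff_comap_le]
      refine @measurable_walk_stopped _ _ (_) n fun i hi => ?_
      exact Measurable.mono (comap_measurable (X i)) (le_iSup₂_of_le i hi le_rfl) le_rfl
  have hprod := (indepFun_iff_map_prod_eq_prod_map_map hYm.aemeasurable hZm.aemeasurable).1 hind
  have hZlaw : P.map Z = P.map (fun ω j => walk X j ω) := by
    ext s hs'
    have := h.lintegral_precomp (e := fun i => n + i) (fun i j hij => by simpa using hij)
      (f := s.indicator 1) (measurable_one.indicator hs')
    rw [← lintegral_indicator_one hs', ← lintegral_indicator_one hs',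
      lintegral_map (measurable_one.indicator hs') hZm,
      lintegral_map (measurable_one.indicator hs') h.measurable_path, hZ]
    exact this
  have e1 : ∫⁻ ω, f (Y ω) (Z ω) ∂P = ∫⁻ p, Function.uncurry f p ∂(P.map fun ω => (Y ω, Z ω)) := by
    rw [lintegral_map hf (by fun_prop)]; rfl
  rw [e1, hprod, hZlaw]
  have := Measure.isProbabilityMeasure_map (μ := P) h.measurable_path.aemeasurable
  rw [lintegral_prod _ hf.aemeasurable, lintegral_map hf.lintegral_prod_right' hYm]
  refine lintegral_congr fun ω => ?_
  rw [lintegral_map (by fun_prop) h.measurable_path]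
  rfl

end IsIIDSteps

end ConditionedWalk

end
-- Decomposition of the killed walk at its last minimum.
noncomputable section

namespace ConditionedWalk

/-- The indicator of the event that the path `x + v` is positive at the times `1, …, N`. -/
def stayInd (x : ℝ) (v : ℕ → ℝ) (N : ℕ) : ℝ≥0∞ :=
  open Classical in if ∀ k, 1 ≤ k → k ≤ N → 0 < x + v k then 1 else 0

/-- The indicator of the event that `n` is a weak descending ladder epoch of `v` with ladder height
below `x`, the epoch `0` being always counted. -/
def ladderInd (x : ℝ) (v : ℕ → ℝ) (n : ℕ) : ℝ≥0∞ :=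
  open Classical in if (∀ k < n, v n ≤ v k) ∧ (n = 0 ∨ -v n < x) then 1 else 0

lemma measurable_stayInd {α : Type*} [MeasurableSpace α] {x : α → ℝ} {v : α → ℕ → ℝ}
    (hx : Measurable x) (hv : Measurable v) (N : ℕ) :
    Measurable fun a => stayInd (x a) (v a) N := by
  unfold stayInd
  refine Measurable.ite ?_ measurable_const measurable_const
  simp only [ofPred_forall]
  refine MeasurableSet.iInter fun k => MeasurableSet.iInter fun _ => MeasurableSet.iInter fun _ => ?_
  exact measurableSet_lt measurable_const (by fun_prop)

lemma measurable_ladderInd {α : Type*} [MeasurableSpace α] {x : α → ℝ} {v : α → ℕ → ℝ}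
    (hx : Measurable x) (hv : Measurable v) (n : ℕ) :
    Measurable fun a => ladderInd (x a) (v a) n := by
  have h1 : MeasurableSet {a | ∀ k < n, v a n ≤ v a k} := by
    simp only [ofPred_forall]
    exact MeasurableSet.iInter fun k => MeasurableSet.iInter fun _ =>
      measurableSet_le (by fun_prop) (by fun_prop)
  have h2 : MeasurableSet {a | n = 0 ∨ -v a n < x a} :=
    (MeasurableSet.const (n = 0)).union (measurableSet_lt (by fun_prop) hx)
  exact Measurable.ite (h1.inter h2) measurable_const measurable_const

lemma ladderInd_congr {x : ℝ} {u v : ℕ → ℝ} {n : ℕ} (h : ∀ k ≤ n, u k = v k) :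
    ladderInd x u n = ladderInd x v n := by
  unfold ladderInd
  have : (∀ k < n, u n ≤ u k) ↔ ∀ k < n, v n ≤ v k :=
    forall₂_congr fun k hk => by rw [h n le_rfl, h k hk.le]
  exact if_congr (and_congr this (by rw [h n le_rfl])) rfl rfl

lemma stayInd_congr {x : ℝ} {u v : ℕ → ℝ} {N : ℕ} (h : ∀ k ≤ N, u k = v k) :
    stayInd x u N = stayInd x v N := by
  unfold stayInd
  have : (∀ k, 1 ≤ k → k ≤ N → 0 < x + u k) ↔ ∀ k, 1 ≤ k → k ≤ N → 0 < x + v k :=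
    forall₃_congr fun k _ hk => by rw [h k hk]
  by_cases hc : ∀ k, 1 ≤ k → k ≤ N → 0 < x + u k
  · rw [if_pos hc, if_pos (this.1 hc)]
  · rw [if_neg hc, if_neg (mt this.2 hc)]

/-- A path stays positive up to the time `N` iff it has a last minimum before `N`, above `-x`. -/
lemma stayInd_eq_sum {v : ℕ → ℝ} (hv : v 0 = 0) {x : ℝ} (hx : 0 ≤ x) (N : ℕ) :
    stayInd x v N = ∑ n ∈ Finset.range (N + 1),
      ladderInd x v n * stayInd 0 (fun j => v (n + j) - v n) (N - n) := by
  by_cases hs : ∀ k, 1 ≤ k → k ≤ N → 0 < x + v k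
  -- This `n` is the last time at which the minimum over `0, …, N` is attained; it indexes the only
  -- nonzero term of the sum.
  · obtain ⟨n, hnN, hmin, hlast⟩ :
        ∃ n ≤ N, (∀ k < n, v n ≤ v k) ∧ ∀ k, n < k → k ≤ N → v n < v k := by
      clear hs
      induction N with
      | zero => exact ⟨0, le_rfl, by simp, by intro k h1 h2; omega⟩
      | succ N ih =>
        obtain ⟨n, hn, h1, h2⟩ := ih
        by_cases h : v n < v (N + 1)
        · refine ⟨n, by omega, h1, fun k hk hkN => ?_⟩
          rcases Nat.lt_or_ge N k with h3 | h3
          · rwa [show k = N + 1 by omega]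
          · exact h2 k hk h3
        · refine ⟨N + 1, le_rfl, fun k hk => (not_lt.1 h).trans ?_, by intro k h1 h2; omega⟩
          rcases lt_trichotomy k n with h3 | h3 | h3
          · exact h1 k h3
          · rw [h3]
          · exact (h2 k h3 (by omega)).le
    rw [Finset.sum_eq_single n]
    · rw [stayInd, if_pos hs, ladderInd, if_pos, stayInd, if_pos, one_mul]
      · intro k h1 h2
        linarith [hlast (n + k) (by omega) (by omega)]
      · refine ⟨hmin, ?_⟩
        rcases Nat.eq_zero_or_pos n with h | h
        · exact .inl h
        · right; linarith [hs n h hnN]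
    · intro m hm hmn
      simp only [Finset.mem_range] at hm
      rcases lt_or_gt_of_ne hmn with h | h
      · rw [stayInd, if_neg, mul_zero]
        intro hc
        have := hc (n - m) (by omega) (by omega)
        rw [show m + (n - m) = n by omega] at this
        linarith [hmin m h]
      · rw [ladderInd, if_neg, zero_mul]
        rintro ⟨h1, -⟩
        linarith [h1 n h, hlast m h (by omega)]
    · intro h; exact absurd (Finset.mem_range.2 (by omega)) h
  · rw [stayInd, if_neg hs]
    symm
    refine Finset.sum_eq_zero fun n hn => ?_
    simp only [Finset.mem_range] at hn
    by_contra hne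
    rw [← ne_eq, mul_ne_zero_iff] at hne
    obtain ⟨h1, h2⟩ := hne
    simp only [ladderInd, stayInd, ne_eq, ite_eq_right_iff, one_ne_zero, imp_false, not_not]
      at h1 h2
    refine hs fun k hk hkN => ?_
    rcases Nat.lt_or_ge n k with h | h
    · have := h2 (k - n) (by omega) (by omega)
      rw [show n + (k - n) = k by omega] at this
      rcases h1.2 with h3 | h3
      · rw [h3, hv] at this; linarith
      · linarith
    · have h3 : v n ≤ v k := by
        rcases h.eq_or_lt with h | h
        · rw [h]
        · exact h1.1 k h
      rcases h1.2 with h4 | h4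
      · omega
      · linarith

lemma tsum_sum_range_sub (a : ℕ → ℕ → ℝ≥0∞) :
    ∑' N, ∑ n ∈ Finset.range (N + 1), a n (N - n) = ∑' n, ∑' m, a n m := by
  simp_rw [← Finset.Nat.sum_antidiagonal_eq_sum_range_succ a]
  rw [← ENNReal.tsum_prod, ← Equiv.tsum_eq Finset.HasAntidiagonal.sigmaAntidiagonalEquivProd,
    ENNReal.tsum_sigma']
  refine tsum_congr fun N => ?_
  rw [← Finset.tsum_subtype]
  rfl

section Green

variable {Ω : Type*} [MeasurableSpace Ω] (P : Measure Ω) (X : ℕ → Ω → ℝ)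

/-- The Green potential of `ψ` at `x` for the walk killed on entering `(-∞, 0]` at a time `≥ 1`. -/
def killedGreen (ψ : ℝ → ℝ≥0∞) (x : ℝ) : ℝ≥0∞ :=
  ∑' N, ∫⁻ ω, stayInd x (walk X · ω) N * ψ (x + walk X N ω) ∂P

/-- The potential at `z` of `ψ` for the walk started at `z` and killed when it returns to
`(-∞, z]`. -/
def climbGreen (ψ : ℝ → ℝ≥0∞) (z : ℝ) : ℝ≥0∞ :=
  ∑' m, ∫⁻ ω, stayInd 0 (walk X · ω) m * ψ (z + walk X m ω) ∂P

variable {P X}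

namespace IsIIDSteps

/-- The clause `n = 0` in `ladderInd` matches the convention `R(0) = 1`: for `x ≤ 0` only that term
survives, ladder heights being nonnegative. -/
lemma renewalFn_eq (h : IsIIDSteps P X) [IsProbabilityMeasure P] (x : ℝ) :
    renewalFn P (walk X) x = ∑' n, ∫⁻ ω, ladderInd x (walk X · ω) n ∂P := by
  have hw := h.measurable_walk
  have hlad (n : ℕ) (ω : Ω) (hl : ∀ k < n, walk X n ω ≤ walk X k ω) : 0 ≤ -walk X n ω := by
    rcases Nat.eq_zero_or_pos n with h0 | h0
    · simp [h0]
    · simpa using hl 0 h0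
  unfold renewalFn
  split_ifs with hx
  · rw [weakDescRenewalMeasure, Measure.sum_apply _ measurableSet_Ico]
    refine tsum_congr fun n => ?_
    have hE : MeasurableSet (weakDescLadderEvent (walk X) n) := by
      simp only [weakDescLadderEvent, ofPred_forall]
      exact MeasurableSet.iInter fun k => MeasurableSet.iInter fun _ =>
        measurableSet_le (hw n) (hw k)
    have hB : MeasurableSet ((fun ω => -walk X n ω) ⁻¹' Ico 0 x) := (hw n).neg measurableSet_Ico
    rw [Measure.map_apply (f := fun ω => -walk X n ω) (hw n).neg measurableSet_Ico,
      Measure.restrict_apply hB,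
      ← lintegral_indicator_one (hB.inter hE)]
    refine lintegral_congr fun ω => ?_
    unfold ladderInd indicator
    congr 1
    simp only [weakDescLadderEvent, mem_inter_iff, mem_preimage, mem_Ico, mem_ofPred_eq, eq_iff_iff]
    constructor
    · rintro ⟨⟨-, h1⟩, h2⟩; exact ⟨h2, .inr h1⟩
    · rintro ⟨h1, h2⟩
      refine ⟨⟨hlad n ω h1, ?_⟩, h1⟩
      rcases h2 with h2 | h2
      · simpa [h2] using hx
      · exact h2
  · rw [tsum_eq_single 0]
    · simp [ladderInd]
    · intro n hn
      rw [lintegral_eq_zero_iff (measurable_ladderInd measurable_const h.measurable_path n)]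
      refine ae_of_all _ fun ω => ?_
      simp only [ladderInd, hn, false_or, Pi.zero_apply, ite_eq_right_iff, one_ne_zero, imp_false]
      rintro ⟨h1, h2⟩
      linarith [hlad n ω h1]

lemma monotone_renewalFn (h : IsIIDSteps P X) [IsProbabilityMeasure P] :
    Monotone (renewalFn P (walk X)) := by
  intro x y hxy
  simp only [h.renewalFn_eq]
  refine ENNReal.tsum_le_tsum fun n => lintegral_mono fun ω => ?_
  unfold ladderInd
  split_ifs with h1 h2 <;> simp
  refine h2 ⟨h1.1, h1.2.imp id fun h => h.trans_le hxy⟩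

lemma measurable_renewalFn (h : IsIIDSteps P X) [IsProbabilityMeasure P] :
    Measurable (renewalFn P (walk X)) := h.monotone_renewalFn.measurable

/-- Split each path at its last minimum and apply the Markov property there: the future is a fresh
walk staying strictly above its start, and summing over its length gives `climbGreen`. -/
lemma killedGreen_eq (h : IsIIDSteps P X) [IsProbabilityMeasure P] {ψ : ℝ → ℝ≥0∞}
    (hψ : Measurable ψ) {x : ℝ} (hx : 0 ≤ x) :
    killedGreen P X ψ x =
      ∑' n, ∫⁻ ω, ladderInd x (walk X · ω) n * climbGreen P X ψ (x + walk X n ω) ∂P := by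
  have hw := h.measurable_walk
  have hp := h.measurable_path
  have hf (n m : ℕ) : Measurable (Function.uncurry fun u v : ℕ → ℝ =>
      ladderInd x u n * (stayInd 0 v m * ψ (x + u n + v m))) := by
    have h1 : Measurable fun p : (ℕ → ℝ) × (ℕ → ℝ) => ladderInd x p.1 n :=
      measurable_ladderInd measurable_const measurable_fst n
    have h2 : Measurable fun p : (ℕ → ℝ) × (ℕ → ℝ) => stayInd 0 p.2 m :=
      measurable_stayInd measurable_const measurable_snd m
    exact h1.mul (h2.mul (hψ.comp (by fun_prop)))
  have key (n m : ℕ) : ∫⁻ ω, ladderInd x (walk X · ω) n *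
        (stayInd 0 (fun j => walk X (n + j) ω - walk X n ω) m * ψ (x + walk X (n + m) ω)) ∂P =
      ∫⁻ ω, ladderInd x (walk X · ω) n *
        ∫⁻ ω', stayInd 0 (walk X · ω') m * ψ (x + walk X n ω + walk X m ω') ∂P ∂P := by
    have := h.lintegral_markov n (hf n m)
    simp only [min_self] at this
    have hc (ω : Ω) : ladderInd x (fun k => walk X (min k n) ω) n = ladderInd x (walk X · ω) n :=
      ladderInd_congr fun k hk => by rw [min_eq_left hk]
    simp only [hc] at this
    convert this using 1
    · refine lintegral_congr fun ω => ?_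
      rw [show x + walk X n ω + (walk X (n + m) ω - walk X n ω) = x + walk X (n + m) ω by ring]
    · refine lintegral_congr fun ω => ?_
      rw [lintegral_const_mul]
      exact (measurable_stayInd measurable_const hp m).mul (hψ.comp (by fun_prop))
  have hmi (n m : ℕ) : Measurable fun ω => ladderInd x (walk X · ω) n *
        ∫⁻ ω', stayInd 0 (walk X · ω') m * ψ (x + walk X n ω + walk X m ω') ∂P := by
    refine (measurable_ladderInd measurable_const hp n).mul ?_
    refine Measurable.lintegral_prod_right' (f := fun q : Ω × Ω =>
      stayInd 0 (walk X · q.2) m * ψ (x + walk X n q.1 + walk X m q.2)) ?_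
    exact (measurable_stayInd measurable_const (hp.comp measurable_snd) m).mul
      (hψ.comp (by fun_prop))
  calc killedGreen P X ψ x
      = ∑' N, ∑ n ∈ Finset.range (N + 1), ∫⁻ ω, ladderInd x (walk X · ω) n *
        (stayInd 0 (fun j => walk X (n + j) ω - walk X n ω) (N - n) *
          ψ (x + walk X (n + (N - n)) ω)) ∂P := by
        refine tsum_congr fun N => ?_
        rw [← lintegral_finsetSum]
        · refine lintegral_congr fun ω => ?_
          rw [stayInd_eq_sum (walk_zero ω) hx, Finset.sum_mul]
          refine Finset.sum_congr rfl fun n hn => ?_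
          rw [show n + (N - n) = N by simp at hn; omega, mul_assoc]
        · intro n _
          refine (measurable_ladderInd measurable_const hp n).mul
            ((measurable_stayInd measurable_const (by fun_prop) _).mul (hψ.comp (by fun_prop)))
    _ = ∑' n, ∑' m, ∫⁻ ω, ladderInd x (walk X · ω) n *
        (stayInd 0 (fun j => walk X (n + j) ω - walk X n ω) m *
          ψ (x + walk X (n + m) ω)) ∂P :=
        tsum_sum_range_sub fun n m => ∫⁻ ω, ladderInd x (walk X · ω) n *
        (stayInd 0 (fun j => walk X (n + j) ω - walk X n ω) m *
          ψ (x + walk X (n + m) ω)) ∂P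
    _ = _ := by
        refine tsum_congr fun n => ?_
        simp only [key]
        rw [← lintegral_tsum fun m => (hmi n m).aemeasurable]
        refine lintegral_congr fun ω => ?_
        rw [ENNReal.tsum_mul_left]
        rfl

omit [MeasurableSpace Ω] in
lemma mem_Icc_of_ladderInd_ne_zero {x : ℝ} (hx : 0 ≤ x) {n : ℕ} {ω : Ω}
    (hl : ladderInd x (walk X · ω) n ≠ 0) : x + walk X n ω ∈ Icc 0 x := by
  simp only [ladderInd, ne_eq, ite_eq_right_iff, one_ne_zero, imp_false, not_not] at hl
  rcases Nat.eq_zero_or_pos n with h0 | h0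
  · simp [h0, hx]
  · have h1 := hl.1 0 h0
    have h2 := hl.2.resolve_left h0.ne'
    simp only [walk_zero] at h1
    constructor <;> linarith

/-- The ladder weights in `killedGreen_eq` have total mass `R(x)`, and the minimum of the path lies
in `[0, x]`. -/
lemma killedGreen_le (h : IsIIDSteps P X) [IsProbabilityMeasure P] {ψ : ℝ → ℝ≥0∞}
    (hψ : Measurable ψ) {x : ℝ} (hx : 0 ≤ x) {b : ℝ≥0∞}
    (hb : ∀ z ∈ Icc 0 x, climbGreen P X ψ z ≤ b) :
    killedGreen P X ψ x ≤ b * renewalFn P (walk X) x := by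
  have hp := h.measurable_path
  rw [h.killedGreen_eq hψ hx, h.renewalFn_eq, ← ENNReal.tsum_mul_left]
  refine ENNReal.tsum_le_tsum fun n => ?_
  rw [← lintegral_const_mul _ (measurable_ladderInd measurable_const hp n)]
  refine lintegral_mono fun ω => ?_
  by_cases hl : ladderInd x (walk X · ω) n = 0
  · simp [hl]
  · rw [mul_comm]
    gcongr
    exact hb _ (mem_Icc_of_ladderInd_ne_zero hx hl)

lemma le_killedGreen (h : IsIIDSteps P X) [IsProbabilityMeasure P] {ψ : ℝ → ℝ≥0∞}
    (hψ : Measurable ψ) {x : ℝ} (hx : 0 ≤ x) {b : ℝ≥0∞}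
    (hb : ∀ z ∈ Icc 0 x, b ≤ climbGreen P X ψ z) :
    b * renewalFn P (walk X) x ≤ killedGreen P X ψ x := by
  have hp := h.measurable_path
  rw [h.killedGreen_eq hψ hx, h.renewalFn_eq, ← ENNReal.tsum_mul_left]
  refine ENNReal.tsum_le_tsum fun n => ?_
  rw [← lintegral_const_mul _ (measurable_ladderInd measurable_const hp n)]
  refine lintegral_mono fun ω => ?_
  by_cases hl : ladderInd x (walk X · ω) n = 0
  · simp [hl]
  · rw [mul_comm]
    gcongr
    exact hb _ (mem_Icc_of_ladderInd_ne_zero hx hl)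

end IsIIDSteps

end Green

end ConditionedWalk

end
-- Linear upper bounds for the renewal functions.
noncomputable section

namespace ConditionedWalk

/-- The paths for which `n` is a weak descending ladder epoch, of height in `[s, s + δ)`. -/
def ladderBand (s δ : ℝ) (n : ℕ) : Set (ℕ → ℝ) :=
  {u | (∀ k < n, u n ≤ u k) ∧ s ≤ -u n ∧ -u n < s + δ}

lemma measurableSet_ladderBand (s δ : ℝ) (n : ℕ) : MeasurableSet (ladderBand s δ n) := by
  have h1 : MeasurableSet {u : ℕ → ℝ | ∀ k < n, u n ≤ u k} := by
    simp only [ofPred_forall]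
    exact MeasurableSet.iInter fun k => MeasurableSet.iInter fun _ =>
      measurableSet_le (by fun_prop) (by fun_prop)
  have h2 : MeasurableSet {u : ℕ → ℝ | s ≤ -u n} := measurableSet_le (by fun_prop) (by fun_prop)
  have h3 : MeasurableSet {u : ℕ → ℝ | -u n < s + δ} :=
    measurableSet_lt (by fun_prop) (by fun_prop)
  exact h1.inter (h2.inter h3)

variable {Ω : Type*} [MeasurableSpace Ω] {P : Measure Ω} {X : ℕ → Ω → ℝ}

namespace IsIIDSteps

lemma neg (h : IsIIDSteps P X) : IsIIDSteps P fun n ω => -X n ω where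
  measurable n := (h.measurable n).neg
  indep := h.indep.comp (fun _ x => -x) fun _ => measurable_neg
  ident n := (h.ident n).comp measurable_neg

/-- The expected number of weak descending ladder heights in an interval of length `δ`. -/
lemma tsum_measure_ladder_band_le (h : IsIIDSteps P X) [IsProbabilityMeasure P] (δ s : ℝ) :
    P {ω | X 0 ω ≤ -δ} * ∑' n, P {ω | (walk X · ω) ∈ ladderBand s δ n} ≤ 1 := by
  have hw := h.measurable_walk
  let A (n : ℕ) : Set (ℕ → ℝ) := ladderBand s δ n
  let B : Set (ℕ → ℝ) := {v | v 1 ≤ -δ}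
  have hA (n : ℕ) : MeasurableSet (A n) := measurableSet_ladderBand s δ n
  have hB : MeasurableSet B := measurableSet_le (by fun_prop) (by fun_prop)
  have hAΩ (n : ℕ) : MeasurableSet {ω | (walk X · ω) ∈ A n} := h.measurable_path (hA n)
  let E (n : ℕ) : Set Ω :=
    {ω | (walk X · ω) ∈ A n} ∩ {ω | (fun j => walk X (n + j) ω - walk X n ω) ∈ B}
  have hE (n : ℕ) : MeasurableSet (E n) :=
    (hAΩ n).inter (hB.preimage (f := fun ω j => walk X (n + j) ω - walk X n ω) (by fun_prop))
  have hprod (n : ℕ) : P (E n) = P {ω | X 0 ω ≤ -δ} * P {ω | (walk X · ω) ∈ A n} := by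
    have hm := h.lintegral_markov n
      (f := fun u v => (A n).indicator 1 u * B.indicator (1 : (ℕ → ℝ) → ℝ≥0∞) v)
      (((measurable_one.indicator (hA n)).comp measurable_fst).mul
        ((measurable_one.indicator hB).comp measurable_snd))
    have hc (ω : Ω) : (A n).indicator (1 : (ℕ → ℝ) → ℝ≥0∞) (fun k => walk X (min k n) ω) =
        {ω | (walk X · ω) ∈ A n}.indicator 1 ω := by
      have : (fun k => walk X (min k n) ω) ∈ A n ↔ (walk X · ω) ∈ A n := by
        simp only [A, ladderBand, mem_ofPred_eq, min_self]
        refine and_congr_left fun _ => forall₂_congr fun k hk => ?_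
        rw [min_eq_left hk.le]
      by_cases hmem : (walk X · ω) ∈ A n
      · rw [indicator_of_mem (this.2 hmem), indicator_of_mem (s := {ω | (walk X · ω) ∈ A n}) hmem]
        rfl
      · rw [indicator_of_notMem (mt this.1 hmem),
          indicator_of_notMem (s := {ω | (walk X · ω) ∈ A n}) hmem]
    simp only [hc] at hm
    have hin : ∫⁻ ω', B.indicator (1 : (ℕ → ℝ) → ℝ≥0∞) (fun j => walk X j ω') ∂P =
        P {ω | X 0 ω ≤ -δ} := by
      have := lintegral_indicator_one (μ := P)
        (measurableSet_le (h.measurable 0) (measurable_const (a := -δ)))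
      rw [← this]
      refine lintegral_congr fun ω => ?_
      simp [indicator, B, walk_one]
    have hBm : Measurable fun ω => B.indicator (1 : (ℕ → ℝ) → ℝ≥0∞) (fun j => walk X j ω) :=
      (measurable_one.indicator hB).comp h.measurable_path
    simp_rw [lintegral_const_mul _ hBm, hin] at hm
    rw [lintegral_mul_const _ (measurable_one.indicator (hAΩ n)),
      lintegral_indicator_one (hAΩ n)] at hm
    rw [mul_comm, ← hm, ← lintegral_indicator_one (hE n)]
    refine lintegral_congr fun ω => ?_
    simp only [E, indicator, mem_inter_iff, mem_ofPred_eq, Pi.one_apply]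
    split_ifs <;> simp_all
  -- A step of size at most `-δ` from a height in the band leads beyond the band, and later ladder
  -- heights are at least as deep; so `E n` occurs for at most one `n`.
  have hdisj : Pairwise (Function.onFun Disjoint E) := by
    refine (pairwise_disjoint_on E).2 fun m n hmn => Set.disjoint_left.2 ?_
    rintro ω ⟨⟨-, h1, -⟩, h2⟩ ⟨⟨h3, -, h4⟩, -⟩
    simp only [B, mem_ofPred_eq] at h2
    have : walk X n ω ≤ walk X (m + 1) ω := by
      rcases (show m + 1 ≤ n from hmn).eq_or_lt with h5 | h5
      · rw [h5]
      · exact h3 _ h5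
    linarith
  rw [← ENNReal.tsum_mul_left]
  calc _ = ∑' n, P (E n) := tsum_congr fun n => (hprod n).symm
    _ ≤ P univ := tsum_measure_le_measure_univ (fun n => (hE n).nullMeasurableSet)
        (hdisj.mono fun _ _ h => h.aedisjoint)
    _ = 1 := measure_univ

lemma exists_renewalFn_le (h : IsIIDSteps P X) [IsProbabilityMeasure P] {δ : ℝ} (hδ : 0 < δ)
    (hX : P {ω | X 0 ω ≤ -δ} ≠ 0) :
    ∃ C : ℝ, 0 < C ∧ ∀ t, 1 ≤ t → renewalFn P (walk X) t ≤ ENNReal.ofReal (C * t) := by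
  set p := (P {ω | X 0 ω ≤ -δ}).toReal with hp
  have hp0 : 0 < p := ENNReal.toReal_pos hX (measure_ne_top _ _)
  have hpe : P {ω | X 0 ω ≤ -δ} = ENNReal.ofReal p :=
    (ENNReal.ofReal_toReal (measure_ne_top _ _)).symm
  -- `⌈t / δ⌉ ≤ (1 / δ + 1) t` bands cover `[0, t)`, using `1 ≤ t`, and each has expected count at
  -- most `1 / p`.
  refine ⟨(1 / δ + 1) / p, by positivity, fun t ht => ?_⟩
  let A (j n : ℕ) : Set Ω := {ω | (walk X · ω) ∈ ladderBand (j * δ) δ n}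
  have hA (j n : ℕ) : MeasurableSet (A j n) :=
    h.measurable_path (measurableSet_ladderBand (j * δ) δ n)
  have hband (j : ℕ) : ∑' n, P (A j n) ≤ ENNReal.ofReal (1 / p) := by
    have := h.tsum_measure_ladder_band_le δ (j * δ)
    rw [hpe] at this
    rw [one_div, ENNReal.ofReal_inv_of_pos hp0, ENNReal.le_inv_iff_mul_le, mul_comm]
    exact this
  have hcover (n : ℕ) (ω : Ω) : ladderInd t (walk X · ω) n ≤
      ∑ j ∈ Finset.range ⌈t / δ⌉₊, (A j n).indicator (1 : Ω → ℝ≥0∞) ω := by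
    unfold ladderInd
    split_ifs with hl
    · have h0 : 0 ≤ -walk X n ω := by
        rcases Nat.eq_zero_or_pos n with h0 | h0
        · simp [h0]
        · simpa using hl.1 0 h0
      have h1 : -walk X n ω < t := by
        rcases hl.2 with h2 | h2
        · subst h2; simp; linarith
        · exact h2
      have h2 : ⌊-walk X n ω / δ⌋₊ ∈ Finset.range ⌈t / δ⌉₊ := by
        rw [Finset.mem_range, Nat.floor_lt (by positivity)]
        exact lt_of_lt_of_le (by gcongr) (Nat.le_ceil _)
      refine le_trans ?_ (Finset.single_le_sum
        (f := fun j => (A j n).indicator (1 : Ω → ℝ≥0∞) ω) (fun _ _ => zero_le) h2)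
      rw [indicator_of_mem]
      · exact le_rfl
      · refine ⟨hl.1, ?_, ?_⟩
        · rw [← le_div_iff₀ hδ]
          exact Nat.floor_le (by positivity)
        · have := Nat.lt_floor_add_one (-walk X n ω / δ)
          rw [div_lt_iff₀ hδ] at this
          linarith
    · exact zero_le
  calc renewalFn P (walk X) t = ∑' n, ∫⁻ ω, ladderInd t (walk X · ω) n ∂P := h.renewalFn_eq t
    _ ≤ ∑' n, ∑ j ∈ Finset.range ⌈t / δ⌉₊, P (A j n) := by
        refine ENNReal.tsum_le_tsum fun n => (lintegral_mono (hcover n)).trans ?_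
        rw [lintegral_finsetSum _ fun j _ => measurable_one.indicator (hA j n)]
        simp only [lintegral_indicator_one (hA _ n), le_refl]
    _ = ∑ j ∈ Finset.range ⌈t / δ⌉₊, ∑' n, P (A j n) :=
        Summable.tsum_finsetSum fun _ _ => ENNReal.summable
    _ ≤ ∑ j ∈ Finset.range ⌈t / δ⌉₊, ENNReal.ofReal (1 / p) := Finset.sum_le_sum fun j _ => hband j
    _ = ENNReal.ofReal (⌈t / δ⌉₊ * (1 / p)) := by
        rw [Finset.sum_const, Finset.card_range, nsmul_eq_mul, ENNReal.ofReal_mul (by positivity),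
          ENNReal.ofReal_natCast]
    _ ≤ _ := by
        apply ENNReal.ofReal_le_ofReal
        have h1 : (⌈t / δ⌉₊ : ℝ) ≤ t / δ + 1 := (Nat.ceil_lt_add_one (by positivity)).le
        have h2 : (⌈t / δ⌉₊ : ℝ) ≤ (1 / δ + 1) * t := by
          have : t / δ = 1 / δ * t := by ring
          nlinarith
        calc (⌈t / δ⌉₊ : ℝ) * (1 / p) ≤ ((1 / δ + 1) * t) * (1 / p) := by gcongr
          _ = _ := by ring

end IsIIDSteps

variable (P X) in
/-- The expected time that the walk spends in `(-∞, t)` before it returns to `(-∞, 0]`. By duality,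
this is the renewal function of the strict ascending ladder heights. -/
def climbFn (t : ℝ) : ℝ≥0∞ := climbGreen P X ((Iio t).indicator 1) 0

lemma monotone_climbFn : Monotone (climbFn P X) := by
  intro s t hst
  unfold climbFn climbGreen
  gcongr

lemma climbGreen_Iio (t z : ℝ) :
    climbGreen P X ((Iio t).indicator 1) z = climbFn P X (t - z) := by
  unfold climbFn climbGreen
  refine tsum_congr fun m => lintegral_congr fun ω => ?_
  simp only [indicator, mem_Iio, zero_add, lt_sub_iff_add_lt', Pi.one_apply]

namespace IsIIDSteps

/-- Time reversal turns staying positive up to `m` into `m` being a strict ascending ladder epoch.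
This is only an inequality because the right side also counts weak ones. -/
lemma climbFn_le_renewalFn_neg (h : IsIIDSteps P X) [IsProbabilityMeasure P] (t : ℝ) :
    climbFn P X t ≤ renewalFn P (walk fun n ω => -X n ω) t := by
  rw [h.neg.renewalFn_eq]
  refine ENNReal.tsum_le_tsum fun m => ?_
  have hf : Measurable fun v : ℕ → ℝ =>
      stayInd 0 v m * (Iio t).indicator (1 : ℝ → ℝ≥0∞) (0 + v m) :=
    (measurable_stayInd measurable_const measurable_id m).mul
      ((measurable_one.indicator measurableSet_Iio).comp (by fun_prop))
  have hrev := h.lintegral_reverse m hf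
  simp only [min_self] at hrev
  have hc (ω : Ω) : stayInd 0 (fun k => walk X (min k m) ω) m = stayInd 0 (walk X · ω) m :=
    stayInd_congr fun k hk => by rw [min_eq_left hk]
  simp only [hc] at hrev
  rw [← hrev]
  refine lintegral_mono fun ω => ?_
  have hneg (k : ℕ) : walk (fun n ω => -X n ω) k ω = -walk X k ω := by simp [walk]
  simp only [stayInd, ladderInd, hneg, indicator, mem_Iio, Nat.sub_self, walk_zero, sub_zero,
    zero_add, Pi.one_apply, neg_neg, neg_le_neg_iff]
  by_cases hs : ∀ k, 1 ≤ k → k ≤ m → 0 < walk X m ω - walk X (m - k) ω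
  · by_cases hl : walk X m ω < t
    · rw [if_pos hs, if_pos hl, if_pos, one_mul]
      refine ⟨fun k hk => ?_, .inr hl⟩
      have := hs (m - k) (by omega) (by omega)
      rw [show m - (m - k) = k by omega] at this
      linarith
    · simp [hl]
  · rw [if_neg hs]; simp

end IsIIDSteps

end ConditionedWalk

end
-- Exit times and the linear lower bounds.
noncomputable section

namespace ConditionedWalk

/-- The paths that stay in `(-s, s)` up to the time `n`. -/
def confined (s : ℝ) (n : ℕ) : Set (ℕ → ℝ) := {u | ∀ k ≤ n, |u k| < s}

lemma measurableSet_confined (s : ℝ) (n : ℕ) : MeasurableSet (confined s n) := by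
  simp only [confined, ofPred_forall]
  refine MeasurableSet.iInter fun k => MeasurableSet.iInter fun _ =>
      measurableSet_lt (Measurable.abs (by fun_prop)) (by fun_prop)

lemma confined_succ_subset (s : ℝ) (n : ℕ) : confined s (n + 1) ⊆ confined s n :=
  fun _ hu k hk => hu k (hk.trans n.le_succ)

variable {Ω : Type*} [MeasurableSpace Ω] {P : Measure Ω} {X : ℕ → Ω → ℝ}

lemma lintegral_sq_add [IsProbabilityMeasure P] {Y : Ω → ℝ} (hL2 : MemLp (Y) 2 P)
    (hmean : ∫ ω, Y ω ∂P = 0) (c : ℝ) :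
    ∫⁻ ω, ENNReal.ofReal ((c + Y ω) ^ 2) ∂P =
      ENNReal.ofReal (c ^ 2) + ENNReal.ofReal (∫ ω, Y ω ^ 2 ∂P) := by
  have hi1 : Integrable (Y) P := hL2.integrable (by norm_num)
  have hi2 : Integrable (fun ω => Y ω ^ 2) P := hL2.integrable_sq
  have he : ∀ ω, (c + Y ω) ^ 2 = c ^ 2 + (2 * c * Y ω + Y ω ^ 2) := fun ω => by ring
  have hint : Integrable (fun ω => 2 * c * Y ω + Y ω ^ 2) P := (hi1.const_mul _).add hi2
  rw [← ofReal_integral_eq_lintegral_ofReal _ (ae_of_all _ fun ω => sq_nonneg _)]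
  · simp_rw [he]
    rw [integral_add (integrable_const _) hint, integral_add (hi1.const_mul _) hi2,
      integral_const_mul, hmean, ENNReal.ofReal_add]
    · simp
    · simp; positivity
    · simp; exact integral_nonneg fun ω => sq_nonneg _
  · simp_rw [he]
    exact (integrable_const _).add hint

namespace IsIIDSteps

/-- The second moment of the walk stopped on leaving `(-s, s)`. -/
lemma exit_moment_le (h : IsIIDSteps P X) [IsProbabilityMeasure P] (hL2 : MemLp (X 0) 2 P)
    (hmean : ∫ ω, X 0 ω ∂P = 0) {s : ℝ} (hs : 0 < s) (n : ℕ) :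
    ∫⁻ ω in {ω | (walk X · ω) ∈ confined s n}, ENNReal.ofReal (walk X n ω ^ 2) ∂P +
      ENNReal.ofReal (s ^ 2) * P {ω | (walk X · ω) ∉ confined s n} ≤
    ENNReal.ofReal (∫ ω, X 0 ω ^ 2 ∂P) *
      ∑ k ∈ Finset.range n, P {ω | (walk X · ω) ∈ confined s k} := by
  have hw := h.measurable_walk
  have hA (k : ℕ) : MeasurableSet {ω | (walk X · ω) ∈ confined s k} :=
    h.measurable_path (measurableSet_confined s k)
  set A : ℕ → Set Ω := fun k => {ω | (walk X · ω) ∈ confined s k} with hAdef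
  have hAsub (k : ℕ) : A (k + 1) ⊆ A k := fun ω hω => confined_succ_subset s k hω
  set σ2 := ENNReal.ofReal (∫ ω, X 0 ω ^ 2 ∂P)
  -- Before exit, each independent centred step adds `σ²` to the second moment, the cross term
  -- vanishing.
  have hstep (k : ℕ) : ∫⁻ ω in A k, ENNReal.ofReal (walk X (k + 1) ω ^ 2) ∂P =
      ∫⁻ ω in A k, ENNReal.ofReal (walk X k ω ^ 2) ∂P + σ2 * P (A k) := by
    have hm := h.lintegral_markov k (f := fun u v => (confined s k).indicator 1 u *
      ENNReal.ofReal ((u k + v 1) ^ 2))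
      (((measurable_one.indicator (measurableSet_confined s k)).comp measurable_fst).mul
        (by fun_prop))
    have hc (ω : Ω) : (confined s k).indicator (1 : (ℕ → ℝ) → ℝ≥0∞)
        (fun j => walk X (min j k) ω) = (A k).indicator 1 ω := by
      have : (fun j => walk X (min j k) ω) ∈ confined s k ↔ ω ∈ A k := by
        refine forall₂_congr fun j hj => ?_
        simp only [min_eq_left hj]
      by_cases hmem : ω ∈ A k
      · rw [indicator_of_mem (this.2 hmem), indicator_of_mem hmem]; rfl
      · rw [indicator_of_notMem (mt this.1 hmem), indicator_of_notMem hmem]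
    simp only [hc, min_self, walk_one, add_sub_cancel] at hm
    have hX := h.measurable 0
    have e1 (f : Ω → ℝ≥0∞) : ∫⁻ ω in A k, f ω ∂P = ∫⁻ ω, (A k).indicator 1 ω * f ω ∂P := by
      rw [← lintegral_indicator (hA k)]
      refine lintegral_congr fun ω => ?_
      by_cases hmem : ω ∈ A k
      · rw [indicator_of_mem hmem, indicator_of_mem hmem, Pi.one_apply, one_mul]
      · rw [indicator_of_notMem hmem, indicator_of_notMem hmem, zero_mul]
    rw [e1, hm, ← setLIntegral_const, ← lintegral_add_right _ measurable_const, e1]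
    refine lintegral_congr fun ω => ?_
    rw [lintegral_const_mul _ (by fun_prop), lintegral_sq_add hL2 hmean]
  induction n with
  | zero =>
    have h0 : {ω | (walk X · ω) ∉ confined s 0} = ∅ := by
      ext ω
      simp [confined, hs]
    simp [h0]
  | succ n ih =>
    rw [Finset.sum_range_succ, mul_add]
    refine le_trans ?_ (add_le_add_left ih _)
    have hsplit : {ω | (walk X · ω) ∉ confined s (n + 1)} =
        {ω | (walk X · ω) ∉ confined s n} ∪ (A n \ A (n + 1)) := by
      ext ω
      have := @hAsub n ω
      simp only [hAdef, mem_ofPred_eq, mem_union, mem_sdiff] at this ⊢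
      tauto
    have hexit : ENNReal.ofReal (s ^ 2) * P (A n \ A (n + 1)) ≤
        ∫⁻ ω in A n \ A (n + 1), ENNReal.ofReal (walk X (n + 1) ω ^ 2) ∂P := by
      rw [← setLIntegral_const]
      refine setLIntegral_mono' ((hA n).diff (hA (n + 1))) fun ω hω => ?_
      apply ENNReal.ofReal_le_ofReal
      have h1 : s ≤ |walk X (n + 1) ω| := by
        by_contra hlt
        refine hω.2 fun k hk => ?_
        rcases hk.eq_or_lt with h2 | h2
        · rw [h2]; exact not_le.1 hlt
        · exact hω.1 k (by omega)
      rw [← sq_abs (walk X (n + 1) ω)]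
      gcongr
    have hun := lintegral_inter_add_sdiff (μ := P)
      (fun ω => ENNReal.ofReal (walk X (n + 1) ω ^ 2)) (A n) (hA (n + 1))
    rw [inter_eq_self_of_subset_right (hAsub n), hstep n] at hun
    calc _ ≤ ∫⁻ ω in A (n + 1), ENNReal.ofReal (walk X (n + 1) ω ^ 2) ∂P +
          (ENNReal.ofReal (s ^ 2) * P {ω | (walk X · ω) ∉ confined s n} +
            ∫⁻ ω in A n \ A (n + 1), ENNReal.ofReal (walk X (n + 1) ω ^ 2) ∂P) := by
          rw [hsplit]
          gcongr
          refine (mul_le_mul_right (measure_union_le _ _) _).trans ?_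
          rw [mul_add]
          gcongr
      _ = ENNReal.ofReal (s ^ 2) * P {ω | (walk X · ω) ∉ confined s n} +
          (∫⁻ ω in A (n + 1), ENNReal.ofReal (walk X (n + 1) ω ^ 2) ∂P +
            ∫⁻ ω in A n \ A (n + 1), ENNReal.ofReal (walk X (n + 1) ω ^ 2) ∂P) := by ring
      _ = _ := by rw [hun]; ring

/-- The series is the mean exit time. If it is finite, the exit probability tends to one, and the
limit in `exit_moment_le` can be taken after dropping the unexited part. -/
lemma sq_le_tsum_confined (h : IsIIDSteps P X) [IsProbabilityMeasure P] (hL2 : MemLp (X 0) 2 P)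
    (hmean : ∫ ω, X 0 ω ∂P = 0) (hpos : 0 < ∫ ω, X 0 ω ^ 2 ∂P) {s : ℝ} (hs : 0 < s) :
    ENNReal.ofReal (s ^ 2) ≤ ENNReal.ofReal (∫ ω, X 0 ω ^ 2 ∂P) *
      ∑' k, P {ω | (walk X · ω) ∈ confined s k} := by
  by_cases htop : ∑' k, P {ω | (walk X · ω) ∈ confined s k} = ∞
  · rw [htop, ENNReal.mul_top (by simpa using hpos)]
    exact le_top
  · have h0 := ENNReal.tendsto_atTop_zero_of_tsum_ne_top htop
    have h1 : Filter.Tendsto (fun n => P {ω | (walk X · ω) ∉ confined s n}) Filter.atTop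
        (nhds 1) := by
      have h2 : ∀ n, P {ω | (walk X · ω) ∉ confined s n} =
          1 - P {ω | (walk X · ω) ∈ confined s n} := fun n =>
        prob_compl_eq_one_sub (h.measurable_path (measurableSet_confined s n))
      simp only [h2]
      simpa using ENNReal.Tendsto.sub tendsto_const_nhds h0 (.inl ENNReal.one_ne_top)
    have h3 := ENNReal.Tendsto.const_mul (a := ENNReal.ofReal (s ^ 2)) h1 (.inl one_ne_zero)
    rw [mul_one] at h3
    refine le_of_tendsto' h3 fun n => ?_
    refine (le_trans le_add_self (h.exit_moment_le hL2 hmean hs n)).trans ?_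
    gcongr
    exact ENNReal.sum_le_tsum _

/-- A path confined to `(-s, s)`, once started from `s`, is positive and below `2s`, so the mean
exit time is at most a killed Green potential. -/
lemma sq_le_renewalFn_mul_climbFn (h : IsIIDSteps P X) [IsProbabilityMeasure P]
    (hL2 : MemLp (X 0) 2 P) (hmean : ∫ ω, X 0 ω ∂P = 0) (hpos : 0 < ∫ ω, X 0 ω ^ 2 ∂P)
    {s : ℝ} (hs : 0 < s) :
    ENNReal.ofReal (s ^ 2) ≤ ENNReal.ofReal (∫ ω, X 0 ω ^ 2 ∂P) *
      (climbFn P X (2 * s) * renewalFn P (walk X) s) := by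
  refine (h.sq_le_tsum_confined hL2 hmean hpos hs).trans ?_
  gcongr
  refine le_trans ?_ (h.killedGreen_le (ψ := (Iio (2 * s)).indicator 1)
    (measurable_one.indicator measurableSet_Iio) hs.le fun z hz => ?_)
  · refine ENNReal.tsum_le_tsum fun n => ?_
    have hA : MeasurableSet {ω | (walk X · ω) ∈ confined s n} :=
      h.measurable_path (measurableSet_confined s n)
    rw [← lintegral_indicator_one hA]
    refine lintegral_mono fun ω => ?_
    by_cases hmem : (walk X · ω) ∈ confined s n
    · have h1 := abs_lt.1 (hmem n le_rfl)
      rw [stayInd, if_pos, indicator_of_mem (s := Iio (2 * s)), one_mul]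
      · exact indicator_le_self _ _ _
      · simp only [mem_Iio]; linarith
      · intro k _ hk
        linarith [abs_lt.1 (hmem k hk)]
    · rw [indicator_of_notMem (by exact hmem)]
      exact zero_le
  · rw [climbGreen_Iio]
    exact monotone_climbFn (by linarith [hz.1])

end IsIIDSteps

/-- Otherwise `Y` is almost surely nonnegative with mean zero, hence null, against the positive
variance. -/
lemma exists_measure_le_neg_ne_zero {Y : Ω → ℝ} (hL2 : MemLp Y 2 P) [IsProbabilityMeasure P]
    (hmean : ∫ ω, Y ω ∂P = 0) (hvar : 0 < variance Y P) :
    ∃ δ : ℝ, 0 < δ ∧ P {ω | Y ω ≤ -δ} ≠ 0 := by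
  by_contra! hc
  have hi : Integrable Y P := hL2.integrable (by norm_num)
  have h1 : ∀ᵐ ω ∂P, 0 ≤ Y ω := by
    have h2 : ∀ n : ℕ, ∀ᵐ ω ∂P, -(1 / ((n : ℝ) + 1)) < Y ω := fun n => by
      have := hc (1 / ((n : ℝ) + 1)) Nat.one_div_pos_of_nat
      rw [ae_iff]
      simpa only [not_lt] using this
    filter_upwards [ae_all_iff.2 h2] with ω hω
    refine le_of_forall_pos_lt_add fun ε hε => ?_
    obtain ⟨n, hn⟩ := exists_nat_one_div_lt hε
    linarith [hω n]
  have h3 := (integral_eq_zero_iff_of_nonneg_ae h1 hi).1 hmean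
  rw [variance_congr h3] at hvar
  simp at hvar

/-- Linear growth of the renewal functions of both ladder height processes. -/
lemma IsIIDSteps.exists_linear_bounds (h : IsIIDSteps P X) [IsProbabilityMeasure P]
    (hL2 : MemLp (X 0) 2 P) (hmean : ∫ ω, X 0 ω ∂P = 0) (hvar : 0 < variance (X 0) P) :
    ∃ c C : ℝ, 0 < c ∧ 0 < C ∧ ∀ t, 1 ≤ t →
      ENNReal.ofReal (c * t) ≤ renewalFn P (walk X) t ∧
      renewalFn P (walk X) t ≤ ENNReal.ofReal (C * t) ∧
      ENNReal.ofReal (c * t) ≤ climbFn P X t ∧ climbFn P X t ≤ ENNReal.ofReal (C * t) := by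
  obtain ⟨δ₁, hδ₁, hp₁⟩ := exists_measure_le_neg_ne_zero hL2 hmean hvar
  obtain ⟨δ₂, hδ₂, hp₂⟩ := exists_measure_le_neg_ne_zero (Y := fun ω => -X 0 ω) hL2.neg
    (by rw [integral_neg, hmean, neg_zero])
    (by rwa [show (fun ω => -X 0 ω) = -X 0 from rfl, variance_neg])
  obtain ⟨C₁, hC₁, hr⟩ := h.exists_renewalFn_le hδ₁ hp₁
  obtain ⟨C₂, hC₂, hv⟩ := h.neg.exists_renewalFn_le hδ₂ hp₂
  have hpos : 0 < ∫ ω, X 0 ω ^ 2 ∂P := by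
    rw [variance_of_integral_eq_zero hL2.aemeasurable hmean] at hvar
    exact hvar
  set σ2 := ∫ ω, X 0 ω ^ 2 ∂P
  set C := max C₁ C₂
  have hC : 0 < C := hC₁.trans_le (le_max_left _ _)
  have hr' (t : ℝ) (ht : 1 ≤ t) : renewalFn P (walk X) t ≤ ENNReal.ofReal (C * t) :=
    (hr t ht).trans (ENNReal.ofReal_le_ofReal (by gcongr; exact le_max_left _ _))
  have hv' (t : ℝ) (ht : 1 ≤ t) : climbFn P X t ≤ ENNReal.ofReal (C * t) :=
    (h.climbFn_le_renewalFn_neg t).trans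
      ((hv t ht).trans (ENNReal.ofReal_le_ofReal (by gcongr; exact le_max_right _ _)))
  -- The product of the two renewal functions is at least of order `t²`, so the linear upper bound
  -- on either one gives a linear lower bound on the other.
  have hlow {a b : ℝ≥0∞} {t : ℝ} (ht : 1 ≤ t) (ha : a ≤ ENNReal.ofReal (C * t))
      (hab : ENNReal.ofReal ((t / 2) ^ 2) ≤ ENNReal.ofReal σ2 * (a * b)) :
      ENNReal.ofReal (1 / (4 * σ2 * C) * t) ≤ b := by
    have ht0 : 0 < t := by linarith
    have h1 : ENNReal.ofReal ((t / 2) ^ 2) ≤ ENNReal.ofReal (σ2 * (C * t)) * b := by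
      rw [ENNReal.ofReal_mul hpos.le, mul_assoc]
      exact hab.trans (by gcongr)
    rw [mul_comm, ← ENNReal.div_le_iff_le_mul (.inl (by simp; positivity)) (.inl (by simp)),
      ← ENNReal.ofReal_div_of_pos (by positivity)] at h1
    refine le_trans (le_of_eq ?_) h1
    congr 1
    field_simp
    norm_num
  refine ⟨1 / (4 * σ2 * C), C, by positivity, hC, fun t ht => ?_⟩
  have key : ENNReal.ofReal ((t / 2) ^ 2) ≤
      ENNReal.ofReal σ2 * (climbFn P X t * renewalFn P (walk X) t) := by
    refine (h.sq_le_renewalFn_mul_climbFn hL2 hmean hpos (s := t / 2) (by linarith)).trans ?_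
    rw [mul_div_cancel₀ t two_ne_zero]
    gcongr
    exact h.monotone_renewalFn (by linarith)
  exact ⟨hlow ht (hv' t ht) key, hr' t ht,
    hlow ht (hr' t ht) (by rwa [mul_comm (climbFn P X t)] at key),
    hv' t ht⟩

end ConditionedWalk

end
-- Green bounds for the conditioned walk on geometric shells.
noncomputable section

namespace ConditionedWalk

/-- The step function with value `w i` on `[K ^ i, K ^ (i + 1))`. -/
def shellFn (K : ℝ) (w : ℕ → ℝ≥0∞) (y : ℝ) : ℝ≥0∞ :=
  ∑' i, w i * (Ico (K ^ i) (K ^ (i + 1))).indicator 1 y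

lemma measurable_shellFn (K : ℝ) (w : ℕ → ℝ≥0∞) : Measurable (shellFn K w) :=
  Measurable.tsum fun _ => (measurable_one.indicator measurableSet_Ico).const_mul _

variable {Ω : Type*} [MeasurableSpace Ω] {P : Measure Ω} {X : ℕ → Ω → ℝ}

lemma killedGreen_mono {φ ψ : ℝ → ℝ≥0∞} (hle : ∀ y, φ y ≤ ψ y) (x : ℝ) :
    killedGreen P X φ x ≤ killedGreen P X ψ x := by
  unfold killedGreen
  gcongr
  exact hle _

lemma climbGreen_mono {φ ψ : ℝ → ℝ≥0∞} (hle : ∀ y, φ y ≤ ψ y) (x : ℝ) :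
    climbGreen P X φ x ≤ climbGreen P X ψ x := by
  unfold climbGreen
  gcongr
  exact hle _

/-- Constants such that, up to them, the walk conditioned to stay positive and started from `x`
spends the time `t ^ 2` at heights of the order `t`. -/
structure GreenBounds (P : Measure Ω) (X : ℕ → Ω → ℝ) (K c C : ℝ) : Prop where
  one_lt : 1 < K
  c_pos : 0 < c
  C_pos : 0 < C
  upper : ∀ t x, 1 ≤ t → 0 ≤ x →
    killedGreen P X ((Iio t).indicator (renewalFn P (walk X))) x ≤
      ENNReal.ofReal (C * t ^ 2) * renewalFn P (walk X) x
  lower : ∀ a x, 1 ≤ a → 0 ≤ x → x ≤ a →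
    ENNReal.ofReal (c * a ^ 2) * renewalFn P (walk X) x ≤
      killedGreen P X ((Ico a (K * a)).indicator (renewalFn P (walk X))) x

namespace IsIIDSteps

lemma climbGreen_const_mul (h : IsIIDSteps P X) {ψ : ℝ → ℝ≥0∞} (hψ : Measurable ψ) (a : ℝ≥0∞)
    (z : ℝ) : climbGreen P X (fun y => a * ψ y) z = a * climbGreen P X ψ z := by
  unfold climbGreen
  rw [← ENNReal.tsum_mul_left]
  refine tsum_congr fun m => ?_
  have hw := h.measurable_walk m
  have hm : Measurable fun ω => stayInd 0 (walk X · ω) m * ψ (z + walk X m ω) :=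
    (measurable_stayInd measurable_const h.measurable_path m).mul (hψ.comp (by fun_prop))
  rw [← lintegral_const_mul _ hm]
  exact lintegral_congr fun ω => by ring

lemma climbGreen_add (h : IsIIDSteps P X) {φ ψ : ℝ → ℝ≥0∞} (hφ : Measurable φ) (z : ℝ) :
    climbGreen P X (fun y => φ y + ψ y) z = climbGreen P X φ z + climbGreen P X ψ z := by
  unfold climbGreen
  rw [← ENNReal.tsum_add]
  refine tsum_congr fun m => ?_
  have hw := h.measurable_walk m
  have hm : Measurable fun ω => stayInd 0 (walk X · ω) m * φ (z + walk X m ω) :=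
    (measurable_stayInd measurable_const h.measurable_path m).mul (hφ.comp (by fun_prop))
  rw [← lintegral_add_left hm]
  exact lintegral_congr fun ω => by ring

lemma killedGreen_tsum (h : IsIIDSteps P X) {ψ : ℕ → ℝ → ℝ≥0∞} (hψ : ∀ i, Measurable (ψ i))
    (w : ℕ → ℝ≥0∞) (x : ℝ) :
    killedGreen P X (fun y => ∑' i, w i * ψ i y) x = ∑' i, w i * killedGreen P X (ψ i) x := by
  unfold killedGreen
  have hm (i N : ℕ) : Measurable fun ω =>
      stayInd x (walk X · ω) N * ψ i (x + walk X N ω) := by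
    have hw := h.measurable_walk N
    exact (measurable_stayInd measurable_const h.measurable_path N).mul
      ((hψ i).comp (by fun_prop))
  simp_rw [← ENNReal.tsum_mul_left]
  rw [ENNReal.tsum_comm]
  refine tsum_congr fun N => ?_
  simp_rw [← lintegral_const_mul _ (hm _ N)]
  rw [← lintegral_tsum fun i => ((hm i N).const_mul _).aemeasurable]
  exact lintegral_congr fun ω => tsum_congr fun i => by ring

/-- Two-sided bounds for the Green measure of the conditioned walk on geometric shells. -/
lemma exists_greenBounds (h : IsIIDSteps P X) [IsProbabilityMeasure P]
    (hL2 : MemLp (X 0) 2 P) (hmean : ∫ ω, X 0 ω ∂P = 0) (hvar : 0 < variance (X 0) P) :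
    ∃ K c C, GreenBounds P X K c C := by
  obtain ⟨c, C, hc, hC, hb⟩ := h.exists_linear_bounds hL2 hmean hvar
  have hr := h.measurable_renewalFn
  -- The ratio `K` makes `V(Ka - z) - V(a - z) ≥ c(K - 1)a - Ca = (c + 1)a ≥ a` for `0 ≤ z ≤ a`:
  -- linear bounds with different constants only control increments over long enough shells.
  refine ⟨2 + (C + 1) / c, c, C ^ 2, ?_, hc, by positivity, ?_, ?_⟩
  · have : 0 < (C + 1) / c := by positivity
    linarith
  · intro t x ht hx
    refine h.killedGreen_le (hr.indicator measurableSet_Iio) hx fun z hz => ?_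
    have h1 : climbGreen P X ((Iio t).indicator (renewalFn P (walk X))) z ≤
        climbGreen P X (fun y => ENNReal.ofReal (C * t) * (Iio t).indicator 1 y) z := by
      refine climbGreen_mono (fun y => ?_) z
      by_cases hy : y ∈ Iio t
      · rw [indicator_of_mem hy, indicator_of_mem hy, Pi.one_apply, mul_one]
        exact (h.monotone_renewalFn (le_of_lt hy)).trans (hb t ht).2.1
      · simp [indicator_of_notMem hy]
    refine h1.trans ?_
    rw [h.climbGreen_const_mul (measurable_one.indicator measurableSet_Iio), climbGreen_Iio,
      show C ^ 2 * t ^ 2 = (C * t) * (C * t) by ring,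
      ENNReal.ofReal_mul (p := C * t) (by positivity)]
    exact mul_le_mul_right ((monotone_climbFn (sub_le_self _ hz.1)).trans (hb t ht).2.2.2) _
  · intro a x ha hx hxa
    set K := 2 + (C + 1) / c with hK
    have hcK : c * K = 2 * c + C + 1 := by rw [hK]; field_simp; ring
    have hK2 : 2 ≤ K := by
      have : 0 < (C + 1) / c := by positivity
      linarith
    refine h.le_killedGreen (hr.indicator measurableSet_Ico) hx fun z hz => ?_
    have h1 : climbGreen P X (fun y => ENNReal.ofReal (c * a) * (Ico a (K * a)).indicator 1 y) z ≤
        climbGreen P X ((Ico a (K * a)).indicator (renewalFn P (walk X))) z := by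
      refine climbGreen_mono (fun y => ?_) z
      by_cases hy : y ∈ Ico a (K * a)
      · rw [indicator_of_mem hy, indicator_of_mem hy, Pi.one_apply, mul_one]
        exact (hb a ha).1.trans (h.monotone_renewalFn hy.1)
      · simp [indicator_of_notMem hy]
    refine le_trans ?_ h1
    rw [h.climbGreen_const_mul (measurable_one.indicator measurableSet_Ico),
      show c * a ^ 2 = (c * a) * a by ring, ENNReal.ofReal_mul (by positivity)]
    gcongr
    have h2 : climbFn P X (K * a - z) ≤
        climbFn P X (a - z) + climbGreen P X ((Ico a (K * a)).indicator 1) z := by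
      rw [← climbGreen_Iio, ← climbGreen_Iio,
        ← h.climbGreen_add (measurable_one.indicator measurableSet_Iio)]
      refine climbGreen_mono (fun y => ?_) z
      by_cases h3 : y < K * a <;> by_cases h4 : y < a <;> simp [indicator, h3, h4]
      all_goals simp [not_lt.1 h4]
    have h3 : ENNReal.ofReal (c * (K * a - a)) ≤ climbFn P X (K * a - z) :=
      (hb (K * a - a) (by nlinarith)).2.2.1.trans
        (monotone_climbFn (by linarith [hz.2]))
    have h4 : climbFn P X (a - z) ≤ ENNReal.ofReal (C * a) :=
      (monotone_climbFn (sub_le_self _ hz.1)).trans (hb a ha).2.2.2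
    have h5 := (h3.trans h2).trans (add_le_add_left h4 _)
    rw [← tsub_le_iff_left, ← ENNReal.ofReal_sub _ (by positivity)] at h5
    refine le_trans (ENNReal.ofReal_le_ofReal ?_) h5
    have : c * (K * a - a) - C * a = (c + 1) * a := by linear_combination a * hcK
    rw [this]
    nlinarith

end IsIIDSteps

namespace GreenBounds

variable {K c C : ℝ}

lemma one_le_pow (hG : GreenBounds P X K c C) (i : ℕ) : 1 ≤ K ^ i := one_le_pow₀ hG.one_lt.le

lemma killedGreen_shellFn (h : IsIIDSteps P X) [IsProbabilityMeasure P] (w : ℕ → ℝ≥0∞) (x : ℝ) :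
    killedGreen P X (fun y => shellFn K w y * renewalFn P (walk X) y) x =
      ∑' i, w i * killedGreen P X
        ((Ico (K ^ i) (K ^ (i + 1))).indicator (renewalFn P (walk X))) x := by
  rw [← h.killedGreen_tsum fun i => h.measurable_renewalFn.indicator measurableSet_Ico]
  congr 1
  funext y
  rw [shellFn, ← ENNReal.tsum_mul_right]
  refine tsum_congr fun i => ?_
  by_cases hy : y ∈ Ico (K ^ i) (K ^ (i + 1)) <;> simp [indicator, hy]

/-- The upper bound is applied at the right end `K ^ (i + 1)` of each shell, whence the factor `K ^
2`. -/
lemma killedGreen_shellFn_le (hG : GreenBounds P X K c C) (h : IsIIDSteps P X)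
    [IsProbabilityMeasure P] (w : ℕ → ℝ≥0∞) {x : ℝ} (hx : 0 ≤ x) :
    killedGreen P X (fun y => shellFn K w y * renewalFn P (walk X) y) x ≤
      ENNReal.ofReal (C * K ^ 2) * (∑' i, w i * ENNReal.ofReal ((K ^ i) ^ 2)) *
        renewalFn P (walk X) x := by
  rw [killedGreen_shellFn h, ← ENNReal.tsum_mul_left, ← ENNReal.tsum_mul_right]
  refine ENNReal.tsum_le_tsum fun i => ?_
  have hC := hG.C_pos
  calc _ ≤ w i * (ENNReal.ofReal (C * (K ^ (i + 1)) ^ 2) * renewalFn P (walk X) x) := by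
        gcongr
        refine le_trans (killedGreen_mono (fun y => ?_) x) (hG.upper _ x (hG.one_le_pow _) hx)
        exact indicator_le_indicator_of_subset Ico_subset_Iio_self (fun _ => zero_le) y
    _ = _ := by
        rw [show C * (K ^ (i + 1)) ^ 2 = (C * K ^ 2) * (K ^ i) ^ 2 by ring,
          ENNReal.ofReal_mul (by positivity)]
        ring

/-- The lower Green bound needs a start below the shell, so shells beginning below `L` must carry no
weight. -/
lemma le_killedGreen_shellFn (hG : GreenBounds P X K c C) (h : IsIIDSteps P X)
    [IsProbabilityMeasure P] {w : ℕ → ℝ≥0∞} {L : ℝ} (hw : ∀ i, K ^ i < L → w i = 0) {x : ℝ}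
    (hx : 0 ≤ x) (hxL : x ≤ L) :
    ENNReal.ofReal c * (∑' i, w i * ENNReal.ofReal ((K ^ i) ^ 2)) * renewalFn P (walk X) x ≤
      killedGreen P X (fun y => shellFn K w y * renewalFn P (walk X) y) x := by
  rw [killedGreen_shellFn h, ← ENNReal.tsum_mul_left, ← ENNReal.tsum_mul_right]
  refine ENNReal.tsum_le_tsum fun i => ?_
  rcases lt_or_ge (K ^ i) L with hi | hi
  · simp [hw i hi]
  · have := hG.lower (K ^ i) x (hG.one_le_pow i) hx (hxL.trans hi)
    rw [← pow_succ'] at this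
    calc _ = w i * (ENNReal.ofReal (c * (K ^ i) ^ 2) * renewalFn P (walk X) x) := by
          rw [ENNReal.ofReal_mul hG.c_pos.le]; ring
      _ ≤ _ := by gcongr

end GreenBounds

end ConditionedWalk

end
-- The Markov property of the conditioned walk, and two probabilistic tools.
noncomputable section

namespace ConditionedWalk

lemma stayInd_zero_add (v : ℕ → ℝ) (n m : ℕ) :
    stayInd 0 v (n + m) = stayInd 0 v n * stayInd (v n) (fun j => v (n + j) - v n) m := by
  have h : (∀ k, 1 ≤ k → k ≤ n + m → 0 < 0 + v k) ↔
      (∀ k, 1 ≤ k → k ≤ n → 0 < 0 + v k) ∧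
        ∀ k, 1 ≤ k → k ≤ m → 0 < v n + (v (n + k) - v n) := by
    constructor
    · refine fun h => ⟨fun k h1 h2 => h k h1 (by omega), fun k h1 h2 => ?_⟩
      simpa using h (n + k) (by omega) (by omega)
    · rintro ⟨h1, h2⟩ k hk1 hk2
      rcases le_or_gt k n with h3 | h3
      · exact h1 k hk1 h3
      · have := h2 (k - n) (by omega) (by omega)
        rw [show n + (k - n) = k by omega] at this
        simpa using this
  unfold stayInd
  by_cases h1 : ∀ k, 1 ≤ k → k ≤ n → 0 < 0 + v k
  · by_cases h2 : ∀ k, 1 ≤ k → k ≤ m → 0 < v n + (v (n + k) - v n)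
    · rw [if_pos h1, if_pos h2, if_pos (h.2 ⟨h1, h2⟩), one_mul]
    · rw [if_neg h2, if_neg fun hc => h2 (h.1 hc).2, mul_zero]
  · rw [if_neg h1, if_neg fun hc => h1 (h.1 hc).1, zero_mul]

variable {Ω Ω' : Type*} [MeasurableSpace Ω] [MeasurableSpace Ω'] {P : Measure Ω} {P' : Measure Ω'}
  {X : ℕ → Ω → ℝ} {ζ : ℕ → Ω' → ℝ}

namespace IsConditionedToStayPositive

lemma lintegral_eq (hζ : IsConditionedToStayPositive P (walk X) P' ζ) (h : IsIIDSteps P X)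
    (n : ℕ) {g : (Fin (n + 1) → ℝ) → ℝ≥0∞} (hg : Measurable g) :
    ∫⁻ ω', g (fun i => ζ i ω') ∂P' = ∫⁻ ω, stayInd 0 (walk X · ω) n *
      (g (fun i => walk X i ω) * renewalFn P (walk X) (walk X n ω)) ∂P := by
  have hw := h.measurable_walk
  have hset : MeasurableSet {ω | ∀ k, 1 ≤ k → k ≤ n → 0 < walk X k ω} := by
    simp only [ofPred_forall]
    exact MeasurableSet.iInter fun k => MeasurableSet.iInter fun _ =>
      MeasurableSet.iInter fun _ => measurableSet_lt measurable_const (hw k)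
  rw [hζ.law n g hg, ← lintegral_indicator hset]
  have : renewalFn P (walk X) 0 = 1 := by simp [renewalFn]
  rw [this, inv_one, one_mul]
  refine lintegral_congr fun ω => ?_
  by_cases hω : ∀ k, 1 ≤ k → k ≤ n → 0 < walk X k ω
  · rw [indicator_of_mem (by exact hω), stayInd, if_pos (by simpa using hω), one_mul]
  · rw [indicator_of_notMem (by exact hω), stayInd, if_neg (by simpa using hω), zero_mul]

/-- The Markov property of the conditioned walk, in integrated form. -/
lemma tsum_lintegral_eq (hζ : IsConditionedToStayPositive P (walk X) P' ζ) (h : IsIIDSteps P X)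
    [IsProbabilityMeasure P] {φ : ℝ → ℝ≥0∞} (hφ : Measurable φ)
    (n : ℕ) {g : (Fin (n + 1) → ℝ) → ℝ≥0∞} (hg : Measurable g) :
    ∑' m, ∫⁻ ω', g (fun i => ζ i ω') * φ (ζ (n + m) ω') ∂P' =
      ∫⁻ ω, stayInd 0 (walk X · ω) n * (g (fun i => walk X i ω) *
        killedGreen P X (fun y => φ y * renewalFn P (walk X) y) (walk X n ω)) ∂P := by
  have hw := h.measurable_walk
  have hp := h.measurable_path
  set ψ : ℝ → ℝ≥0∞ := fun y => φ y * renewalFn P (walk X) y with hψdef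
  have hψ : Measurable ψ := hφ.mul h.measurable_renewalFn
  have hterm (m : ℕ) : ∫⁻ ω', g (fun i => ζ i ω') * φ (ζ (n + m) ω') ∂P' =
      ∫⁻ ω, stayInd 0 (walk X · ω) n * g (fun i => walk X i ω) *
        ∫⁻ ω', stayInd (walk X n ω) (walk X · ω') m * ψ (walk X n ω + walk X m ω') ∂P ∂P := by
    have hg' : Measurable fun y : Fin (n + m + 1) → ℝ =>
        g (fun i => y (Fin.castLE (by omega) i)) * φ (y (Fin.last _)) :=
      (hg.comp (by fun_prop)).mul (hφ.comp (by fun_prop))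
    have h1 := hζ.lintegral_eq h (n + m) hg'
    simp only [Fin.val_castLE, Fin.val_last] at h1
    rw [h1]
    have hf : Measurable (Function.uncurry fun u v : ℕ → ℝ =>
        stayInd 0 u n * g (fun i : Fin (n + 1) => u i) *
          (stayInd (u n) v m * ψ (u n + v m))) := by
      refine Measurable.mul (Measurable.mul ?_ (hg.comp (by fun_prop))) (Measurable.mul ?_ ?_)
      · exact measurable_stayInd measurable_const measurable_fst n
      · exact measurable_stayInd (by fun_prop) measurable_snd m
      · exact hψ.comp (by fun_prop)
    have h2 := h.lintegral_markov n hf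
    have hmin (i : Fin (n + 1)) : min (i : ℕ) n = i := by omega
    have hc (ω : Ω) : stayInd 0 (fun k => walk X (min k n) ω) n = stayInd 0 (walk X · ω) n :=
      stayInd_congr fun k hk => by rw [min_eq_left hk]
    simp only [hmin, hc, min_self] at h2
    have hm (ω : Ω) : Measurable fun ω' =>
        stayInd (walk X n ω) (walk X · ω') m * ψ (walk X n ω + walk X m ω') :=
      (measurable_stayInd measurable_const hp m).mul (hψ.comp (by fun_prop))
    simp_rw [fun ω => lintegral_const_mul (μ := P) (stayInd 0 (walk X · ω) n *
      g (fun i : Fin (n + 1) => walk X i ω)) (hm ω)] at h2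
    rw [← h2]
    refine lintegral_congr fun ω => ?_
    rw [stayInd_zero_add, hψdef]
    simp only [add_sub_cancel]
    ring
  simp_rw [hterm]
  rw [← lintegral_tsum]
  · refine lintegral_congr fun ω => ?_
    rw [ENNReal.tsum_mul_left, mul_assoc]
    rfl
  · intro m
    refine (Measurable.mul (Measurable.mul ?_ (hg.comp (by fun_prop))) ?_).aemeasurable
    · exact measurable_stayInd measurable_const hp n
    · refine Measurable.lintegral_prod_right' (f := fun q : Ω × Ω =>
        stayInd (walk X n q.1) (walk X · q.2) m * ψ (walk X n q.1 + walk X m q.2)) ?_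
      exact (measurable_stayInd (by fun_prop) (hp.comp measurable_snd) m).mul
        (hψ.comp (by fun_prop))

omit [MeasurableSpace Ω] in
lemma walk_nonneg_of_stayInd_ne_zero {n : ℕ} {ω : Ω}
    (hs : stayInd 0 (walk X · ω) n ≠ 0) : 0 ≤ walk X n ω := by
  simp only [stayInd, ne_eq, ite_eq_right_iff, one_ne_zero, imp_false, not_not, zero_add] at hs
  rcases Nat.eq_zero_or_pos n with h0 | h0
  · simp [h0]
  · exact (hs n h0 le_rfl).le

lemma ae_nonneg (hζ : IsConditionedToStayPositive P (walk X) P' ζ) (h : IsIIDSteps P X) (n : ℕ) :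
    ∀ᵐ ω' ∂P', 0 ≤ ζ n ω' := by
  have hI : Measurable ((Iio (0 : ℝ)).indicator (1 : ℝ → ℝ≥0∞)) :=
    measurable_one.indicator measurableSet_Iio
  have h1 := hζ.lintegral_eq h n (g := fun y => (Iio 0).indicator 1 (y (Fin.last n)))
    (hI.comp (by fun_prop))
  have h2 : ∫⁻ ω', (Iio (0 : ℝ)).indicator (1 : ℝ → ℝ≥0∞) (ζ n ω') ∂P' = 0 := by
    refine h1.trans (lintegral_eq_zero_of_ae_eq_zero (ae_of_all _ fun ω => ?_))
    by_cases hs : stayInd 0 (walk X · ω) n = 0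
    · simp [hs]
    · have := walk_nonneg_of_stayInd_ne_zero hs
      simp [this]
  have hIζ : Measurable fun ω' => (Iio (0 : ℝ)).indicator (1 : ℝ → ℝ≥0∞) (ζ n ω') :=
    hI.comp (hζ.measurable n)
  rw [lintegral_eq_zero_iff hIζ] at h2
  filter_upwards [h2] with ω' hω'
  by_contra hc
  simp [not_le.1 hc] at hω'

/-- A bound on `G(φR)` by a multiple of `R` restores the Doob weight at time `n`; being uniform in
the height, it can be iterated for second moments. -/
lemma tsum_lintegral_le (hζ : IsConditionedToStayPositive P (walk X) P' ζ) (h : IsIIDSteps P X)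
    [IsProbabilityMeasure P] {φ : ℝ → ℝ≥0∞} (hφ : Measurable φ) {B : ℝ≥0∞}
    (hB : ∀ x, 0 ≤ x → killedGreen P X (fun y => φ y * renewalFn P (walk X) y) x ≤
      B * renewalFn P (walk X) x)
    (n : ℕ) {g : (Fin (n + 1) → ℝ) → ℝ≥0∞} (hg : Measurable g) :
    ∑' m, ∫⁻ ω', g (fun i => ζ i ω') * φ (ζ (n + m) ω') ∂P' ≤
      B * ∫⁻ ω', g (fun i => ζ i ω') ∂P' := by
  have hw := h.measurable_walk
  rw [hζ.tsum_lintegral_eq h hφ n hg, hζ.lintegral_eq h n hg, ← lintegral_const_mul]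
  · refine lintegral_mono fun ω => ?_
    by_cases hs : stayInd 0 (walk X · ω) n = 0
    · simp [hs]
    · calc _ ≤ stayInd 0 (walk X · ω) n * (g (fun i => walk X i ω) *
            (B * renewalFn P (walk X) (walk X n ω))) := by
            gcongr
            exact hB _ (walk_nonneg_of_stayInd_ne_zero hs)
        _ = _ := by ring
  · exact (measurable_stayInd measurable_const h.measurable_path n).mul
      ((hg.comp (by fun_prop)).mul (h.measurable_renewalFn.comp (hw n)))

lemma le_tsum_lintegral (hζ : IsConditionedToStayPositive P (walk X) P' ζ) (h : IsIIDSteps P X)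
    [IsProbabilityMeasure P] {φ : ℝ → ℝ≥0∞} (hφ : Measurable φ) {B : ℝ≥0∞} {L : ℝ}
    (hB : ∀ x, 0 ≤ x → x ≤ L → B * renewalFn P (walk X) x ≤
      killedGreen P X (fun y => φ y * renewalFn P (walk X) y) x)
    (n : ℕ) {g : (Fin (n + 1) → ℝ) → ℝ≥0∞} (hg : Measurable g)
    (hgL : ∀ y, g y ≠ 0 → y (Fin.last n) ≤ L) :
    B * ∫⁻ ω', g (fun i => ζ i ω') ∂P' ≤
      ∑' m, ∫⁻ ω', g (fun i => ζ i ω') * φ (ζ (n + m) ω') ∂P' := by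
  have hw := h.measurable_walk
  rw [hζ.tsum_lintegral_eq h hφ n hg, hζ.lintegral_eq h n hg, ← lintegral_const_mul]
  · refine lintegral_mono fun ω => ?_
    by_cases hs : stayInd 0 (walk X · ω) n = 0
    · simp [hs]
    · by_cases hgz : g (fun i => walk X i ω) = 0
      · simp [hgz]
      · calc _ = stayInd 0 (walk X · ω) n * (g (fun i => walk X i ω) *
              (B * renewalFn P (walk X) (walk X n ω))) := by ring
          _ ≤ _ := by
            gcongr
            exact hB _ (walk_nonneg_of_stayInd_ne_zero hs) (hgL _ hgz)
  · exact (measurable_stayInd measurable_const h.measurable_path n).mul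
      ((hg.comp (by fun_prop)).mul (h.measurable_renewalFn.comp (hw n)))

end IsConditionedToStayPositive

/-- Ordering the pairs of times prepares the use of the Markov property at the earlier one. -/
lemma sq_tsum_le (a : ℕ → ℝ≥0∞) : (∑' i, a i) ^ 2 ≤ 2 * ∑' i, ∑' j, a i * a (i + j) := by
  have hshift (i : ℕ) : ∑' j, a i * a (i + j) = ∑' k, if i ≤ k then a i * a k else 0 := by
    rw [← (add_right_injective i).tsum_eq (f := fun k => if i ≤ k then a i * a k else 0)]
    · simp
    · intro k hk
      simp only [Function.mem_support, ne_eq, ite_eq_right_iff, not_forall] at hk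
      obtain ⟨hk, -⟩ := hk
      exact ⟨k - i, by simp; omega⟩
  simp_rw [hshift]
  calc (∑' i, a i) ^ 2 = ∑' i, ∑' k, a i * a k := by
        rw [sq, ← ENNReal.tsum_mul_right]
        exact tsum_congr fun i => ENNReal.tsum_mul_left.symm
    _ ≤ ∑' i, ∑' k, ((if i ≤ k then a i * a k else 0) + if k ≤ i then a k * a i else 0) := by
        gcongr with i k
        rcases le_total i k with hik | hik
        · rw [if_pos hik]; exact le_self_add
        · rw [if_pos hik, mul_comm]; exact le_add_self
    _ = _ := by
        simp_rw [ENNReal.tsum_add]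
        rw [ENNReal.tsum_comm (f := fun i k => if k ≤ i then a k * a i else 0), two_mul]

/-- A form of the Paley–Zygmund inequality. -/
lemma paley_zygmund {α : Type*} [MeasurableSpace α] (μ : Measure α) [IsFiniteMeasure μ]
    {A : α → ℝ≥0∞} (hA : Measurable A) {b V : ℝ} (hb : 0 < b) (hV : 0 < V)
    (h1 : ENNReal.ofReal b * μ univ ≤ ∫⁻ x, A x ∂μ)
    (h2 : ∫⁻ x, A x ^ 2 ∂μ ≤ ENNReal.ofReal V * μ univ) :
    ENNReal.ofReal (b ^ 2 / (4 * V)) * μ univ ≤ μ {x | ENNReal.ofReal (b / 2) ≤ A x} := by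
  have hS : MeasurableSet {x | ENNReal.ofReal (b / 2) ≤ A x} := measurableSet_le measurable_const hA
  -- Where `A ≥ b / 2`, this follows from `(bA - 2V)² ≥ 0`. After integration the first two terms
  -- take at most `b / 2 + b / 4` of the mean `b`, leaving `b / 4` for the last one.
  have hpt (x : α) : A x ≤ ENNReal.ofReal (b / 2) + ENNReal.ofReal (b / (4 * V)) * A x ^ 2 +
      ENNReal.ofReal (V / b) * {x | ENNReal.ofReal (b / 2) ≤ A x}.indicator 1 x := by
    by_cases hx : ENNReal.ofReal (b / 2) ≤ A x
    · rw [indicator_of_mem (by exact hx), Pi.one_apply, mul_one]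
      by_cases htop : A x = ∞
      · rw [htop, ENNReal.top_pow two_ne_zero, ENNReal.mul_top (by simp; positivity)]
        simp
      · rw [← ENNReal.ofReal_toReal htop, ← ENNReal.ofReal_pow ENNReal.toReal_nonneg,
          ← ENNReal.ofReal_mul (by positivity), ← ENNReal.ofReal_add (by positivity) (by positivity),
          ← ENNReal.ofReal_add (by positivity) (by positivity)]
        apply ENNReal.ofReal_le_ofReal
        set y := (A x).toReal
        have : b / 2 + b / (4 * V) * y ^ 2 + V / b - y =
            b / 2 + (b * y - 2 * V) ^ 2 / (4 * V * b) := by field_simp; ring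
        have h3 : 0 ≤ b / 2 + (b * y - 2 * V) ^ 2 / (4 * V * b) := by positivity
        linarith
    · exact (not_le.1 hx).le.trans (le_add_right le_self_add)
  have h3 : ∫⁻ x, A x ∂μ ≤ ENNReal.ofReal (b / 2) * μ univ +
      ENNReal.ofReal (b / (4 * V)) * ∫⁻ x, A x ^ 2 ∂μ +
      ENNReal.ofReal (V / b) * μ {x | ENNReal.ofReal (b / 2) ≤ A x} := by
    refine (lintegral_mono hpt).trans_eq ?_
    rw [lintegral_add_right _ ((measurable_one.indicator hS).const_mul _),
      lintegral_add_right _ ((hA.pow_const 2).const_mul _), lintegral_const,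
      lintegral_const_mul _ (hA.pow_const 2), lintegral_const_mul _ (measurable_one.indicator hS),
      lintegral_indicator_one hS]
  have h4 := (h1.trans h3).trans (add_le_add_left (add_le_add_right (mul_le_mul_right h2 _) _) _)
  set q := μ univ with hq
  set M := μ {x | ENNReal.ofReal (b / 2) ≤ A x} with hM
  have hqt : q ≠ ∞ := measure_ne_top _ _
  have hMt : M ≠ ∞ := measure_ne_top _ _
  rw [← ENNReal.ofReal_toReal hqt, ← ENNReal.ofReal_toReal hMt] at h4 ⊢
  have hq0 : 0 ≤ q.toReal := ENNReal.toReal_nonneg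
  have hM0 : 0 ≤ M.toReal := ENNReal.toReal_nonneg
  simp only [← ENNReal.ofReal_mul hV.le, ← ENNReal.ofReal_mul hb.le,
    ← ENNReal.ofReal_mul (show 0 ≤ b / 2 by positivity),
    ← ENNReal.ofReal_mul (show 0 ≤ b / (4 * V) by positivity),
    ← ENNReal.ofReal_mul (show 0 ≤ V / b by positivity),
    ← ENNReal.ofReal_mul (show 0 ≤ b ^ 2 / (4 * V) by positivity)] at h4 ⊢
  rw [← ENNReal.ofReal_add (by positivity) (by positivity),
    ← ENNReal.ofReal_add (by positivity) (by positivity),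
    ENNReal.ofReal_le_ofReal_iff (by positivity)] at h4
  apply ENNReal.ofReal_le_ofReal
  have h5 : b / (4 * V) * (V * q.toReal) = b / 4 * q.toReal := by field_simp
  rw [h5] at h4
  have h6 : b / 4 * q.toReal ≤ V / b * M.toReal := by linarith
  have h7 := mul_le_mul_of_nonneg_left h6 (show 0 ≤ b / V by positivity)
  calc b ^ 2 / (4 * V) * q.toReal = b / V * (b / 4 * q.toReal) := by field_simp
    _ ≤ b / V * (V / b * M.toReal) := h7
    _ = M.toReal := by field_simp

/-- An event that has conditional probability at least `κ` given each cylinder event is almost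
sure. -/
lemma measure_compl_eq_zero_of_cylinders (Q : Measure (ℕ → ℝ)) [IsFiniteMeasure Q]
    {E : Set (ℕ → ℝ)} (hE : MeasurableSet E) {κ : ℝ≥0∞} (hκ : κ ≠ 0) (hκt : κ ≠ ∞)
    (h : ∀ D ∈ measurableCylinders fun _ : ℕ => ℝ, κ * Q D ≤ Q (D ∩ E)) : Q Eᶜ = 0 := by
  have hring : IsSetRing (measurableCylinders fun _ : ℕ => ℝ) :=
    ⟨empty_mem_measurableCylinders _, fun _ _ => union_mem_measurableCylinders,
      fun _ _ => sdiff_mem_measurableCylinders⟩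
  -- Approximate `Eᶜ` by a cylinder `D`. Then `D ∩ E` is small, so by hypothesis `D` is small, and
  -- so is `Eᶜ`.
  have hle (ε : ℝ≥0∞) (hε : 0 < ε) : κ * Q Eᶜ ≤ (1 + κ) * ε := by
    obtain ⟨D, hD, hDE⟩ := exists_measure_symmDiff_lt_of_generateFrom_isSetRing (μ := Q) hring
      ⟨{univ}, countable_singleton _, by simpa using univ_mem_measurableCylinders fun _ : ℕ => ℝ,
        by simp⟩
      generateFrom_measurableCylinders.symm hE.compl hε
    have h1 : Q (D ∩ E) ≤ ε :=
      (measure_mono fun x hx => .inl ⟨hx.1, by simpa using hx.2⟩).trans hDE.le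
    have h2 : Q Eᶜ ≤ Q D + ε := by
      refine (measure_mono (t := D ∪ (symmDiff D Eᶜ)) fun x hx => ?_).trans
        ((measure_union_le _ _).trans (by gcongr))
      by_cases hxD : x ∈ D
      · exact .inl hxD
      · exact .inr (.inr ⟨hx, hxD⟩)
    calc κ * Q Eᶜ ≤ κ * (Q D + ε) := by gcongr
      _ = κ * Q D + κ * ε := mul_add _ _ _
      _ ≤ ε + κ * ε := by gcongr; exact (h D hD).trans h1
      _ = (1 + κ) * ε := by ring
  have h0 : κ * Q Eᶜ = 0 := by
    have := ENNReal.Tendsto.const_mul (a := 1 + κ) ENNReal.tendsto_inv_nat_nhds_zero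
      (.inr (by simp [hκt]))
    rw [mul_zero] at this
    exact le_antisymm (ge_of_tendsto' this fun n => hle _ (by simp)) zero_le
  exact (mul_eq_zero.1 h0).resolve_left hκ

end ConditionedWalk

end
-- The integral test, and convergence or divergence of the additive functional.
noncomputable section

namespace ConditionedWalk

section Shell

variable {K : ℝ}

lemma shellFn_le (hK : 1 < K) {w : ℕ → ℝ≥0∞} {y : ℝ} {a : ℝ≥0∞}
    (h : ∀ i, K ^ i ≤ y → y < K ^ (i + 1) → w i ≤ a) : shellFn K w y ≤ a := by
  unfold shellFn
  by_cases hy : ∃ i, y ∈ Ico (K ^ i) (K ^ (i + 1))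
  · obtain ⟨i, hi⟩ := hy
    rw [tsum_eq_single i]
    · simpa [hi] using h i hi.1 hi.2
    · intro j hj
      have hyj : y ∉ Ico (K ^ j) (K ^ (j + 1)) := by
        intro hyj
        have h1 := (pow_lt_pow_iff_right₀ hK).1 (hi.1.trans_lt hyj.2)
        have h2 := (pow_lt_pow_iff_right₀ hK).1 (hyj.1.trans_lt hi.2)
        omega
      simp [indicator_of_notMem hyj]
  · push Not at hy
    simp [indicator_of_notMem (hy _)]

lemma le_shellFn {w : ℕ → ℝ≥0∞} {y : ℝ} {i : ℕ} (h1 : K ^ i ≤ y) (h2 : y < K ^ (i + 1)) :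
    w i ≤ shellFn K w y := by
  refine le_trans ?_ (ENNReal.le_tsum i)
  simp [indicator_of_mem (show y ∈ Ico (K ^ i) (K ^ (i + 1)) from ⟨h1, h2⟩)]

lemma le_indicator_add_shellFn (hK : 1 < K) {f : ℝ → ℝ≥0∞} {a : ℝ≥0∞} {w : ℕ → ℝ≥0∞}
    (ha : ∀ y, 0 ≤ y → y < 1 → f y ≤ a)
    (hw : ∀ i y, K ^ i ≤ y → y < K ^ (i + 1) → f y ≤ w i) {y : ℝ} (hy : 0 ≤ y) :
    f y ≤ a * (Iio 1).indicator 1 y + shellFn K w y := by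
  rcases lt_or_ge y 1 with h1 | h1
  · rw [indicator_of_mem (by exact h1), Pi.one_apply, mul_one]
    exact (ha y hy h1).trans le_self_add
  · obtain ⟨i, hi1, hi2⟩ := exists_nat_pow_near h1 hK
    exact (hw i y hi1 hi2).trans ((le_shellFn hi1 hi2).trans le_add_self)

lemma setLIntegral_shellFn (hK : 1 < K) (w : ℕ → ℝ≥0∞) :
    ∫⁻ y in Ici (0 : ℝ), shellFn K w y = ∑' i, w i * ENNReal.ofReal (K ^ (i + 1) - K ^ i) := by
  unfold shellFn
  have hm (i : ℕ) : Measurable ((Ico (K ^ i) (K ^ (i + 1))).indicator (1 : ℝ → ℝ≥0∞)) :=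
    measurable_one.indicator measurableSet_Ico
  rw [lintegral_tsum fun i => ((hm i).const_mul _).aemeasurable]
  refine tsum_congr fun i => ?_
  rw [lintegral_const_mul _ (hm i), lintegral_indicator_one measurableSet_Ico,
    Measure.restrict_apply measurableSet_Ico, inter_eq_self_of_subset_left, Real.volume_Ico]
  intro y hy
  exact (pow_nonneg (by linarith) i).trans hy.1

variable {F : ℝ → ℝ}

/-- Upper estimates use `F` at the left end of a shell, lower ones at the right end; this index
shift shows that the two series diverge together. -/
lemma tsum_shell_eq (hK : 1 < K) (F : ℝ → ℝ) :
    ∑' i : ℕ, ENNReal.ofReal (F (K ^ i)) * ENNReal.ofReal ((K ^ i) ^ 2) =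
      ENNReal.ofReal (F 1) + ENNReal.ofReal (K ^ 2) *
        ∑' i : ℕ, ENNReal.ofReal (F (K ^ (i + 1))) * ENNReal.ofReal ((K ^ i) ^ 2) := by
  rw [tsum_eq_zero_add' ENNReal.summable, ← ENNReal.tsum_mul_left]
  congr 1
  · simp
  · refine tsum_congr fun i => ?_
    rw [show (K ^ (i + 1)) ^ 2 = K ^ 2 * (K ^ i) ^ 2 by ring, ENNReal.ofReal_mul (by positivity)]
    ring

/-- The integral test on geometric shells. -/
lemma setLIntegral_eq_top_iff (hK : 1 < K) (hF0 : ∀ y, 0 ≤ F y) (hF : Antitone F) :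
    ∫⁻ y in Ici (0 : ℝ), ENNReal.ofReal (F y * y) = ∞ ↔
      ∑' i : ℕ, ENNReal.ofReal (F (K ^ (i + 1))) * ENNReal.ofReal ((K ^ i) ^ 2) = ∞ := by
  have hK0 : 0 < K := by linarith
  constructor
  · contrapose!
    intro hJ
    have hle : ∫⁻ y in Ici (0 : ℝ), ENNReal.ofReal (F y * y) ≤
        ∫⁻ y in Ici (0 : ℝ), (ENNReal.ofReal (F 0) * (Iio 1).indicator 1 y +
          shellFn K (fun i => ENNReal.ofReal (F (K ^ i) * K ^ (i + 1))) y) := by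
      refine setLIntegral_mono' measurableSet_Ici fun y hy => ?_
      refine le_indicator_add_shellFn hK (f := fun y => ENNReal.ofReal (F y * y)) ?_ ?_ hy
      · intro y h0 h1
        apply ENNReal.ofReal_le_ofReal
        have h2 := hF h0
        nlinarith [hF0 y]
      · intro i y h1 h2
        apply ENNReal.ofReal_le_ofReal
        have h3 := hF h1
        have h4 : 0 < K ^ i := by positivity
        exact mul_le_mul h3 h2.le (by linarith) (hF0 _)
    have hI : Measurable ((Iio (1 : ℝ)).indicator (1 : ℝ → ℝ≥0∞)) :=
      measurable_one.indicator measurableSet_Iio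
    refine ne_top_of_le_ne_top ?_ hle
    rw [lintegral_add_right _ (measurable_shellFn _ _), setLIntegral_shellFn hK,
      lintegral_const_mul _ hI, lintegral_indicator_one measurableSet_Iio,
      Measure.restrict_apply measurableSet_Iio]
    refine ENNReal.add_ne_top.2 ⟨ENNReal.mul_ne_top ENNReal.ofReal_ne_top ?_, ?_⟩
    · rw [inter_comm, Ici_inter_Iio, Real.volume_Ico]
      exact ENNReal.ofReal_ne_top
    · refine ne_top_of_le_ne_top (b := ENNReal.ofReal (K ^ 2) *
        ∑' i : ℕ, ENNReal.ofReal (F (K ^ i)) * ENNReal.ofReal ((K ^ i) ^ 2)) ?_ ?_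
      · rw [tsum_shell_eq hK]
        exact ENNReal.mul_ne_top ENNReal.ofReal_ne_top (ENNReal.add_ne_top.2
          ⟨ENNReal.ofReal_ne_top, ENNReal.mul_ne_top ENNReal.ofReal_ne_top hJ⟩)
      · rw [← ENNReal.tsum_mul_left]
        refine ENNReal.tsum_le_tsum fun i => ?_
        have h1 := hF0 (K ^ i)
        rw [← ENNReal.ofReal_mul (by positivity), ← ENNReal.ofReal_mul h1,
          ← ENNReal.ofReal_mul (by positivity)]
        apply ENNReal.ofReal_le_ofReal
        have h2 : 0 < K ^ i := by positivity
        calc F (K ^ i) * K ^ (i + 1) * (K ^ (i + 1) - K ^ i)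
            ≤ F (K ^ i) * K ^ (i + 1) * K ^ (i + 1) := by gcongr; linarith
          _ = _ := by ring
  · contrapose!
    intro hint hJ
    have hle : ENNReal.ofReal (K - 1) *
        ∑' i : ℕ, ENNReal.ofReal (F (K ^ (i + 1))) * ENNReal.ofReal ((K ^ i) ^ 2) ≤
        ∫⁻ y in Ici (0 : ℝ), ENNReal.ofReal (F y * y) := by
      calc _ = ∫⁻ y in Ici (0 : ℝ),
            shellFn K (fun i => ENNReal.ofReal (F (K ^ (i + 1)) * K ^ i)) y := by
            rw [setLIntegral_shellFn hK, ← ENNReal.tsum_mul_left]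
            refine tsum_congr fun i => ?_
            have h1 := hF0 (K ^ (i + 1))
            rw [← ENNReal.ofReal_mul h1, ← ENNReal.ofReal_mul (by linarith),
              ← ENNReal.ofReal_mul (by positivity)]
            congr 1
            ring
        _ ≤ _ := by
            refine lintegral_mono fun y => shellFn_le hK fun i h1 h2 => ?_
            apply ENNReal.ofReal_le_ofReal
            exact mul_le_mul (hF h2.le) h1 (by positivity) (hF0 _)
    rw [hJ, ENNReal.mul_top (by simpa using hK)] at hle
    exact hint (top_le_iff.1 hle)

end Shell

variable {Ω Ω' : Type*} [MeasurableSpace Ω] [MeasurableSpace Ω'] {P : Measure Ω} {P' : Measure Ω'}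
  {X : ℕ → Ω → ℝ} {ζ : ℕ → Ω' → ℝ} {K c C : ℝ}

namespace IsConditionedToStayPositive

/-- The second moment of an additive functional. -/
lemma lintegral_sq_tsum_le (hζ : IsConditionedToStayPositive P (walk X) P' ζ)
    (h : IsIIDSteps P X) [IsProbabilityMeasure P] {φ : ℝ → ℝ≥0∞} (hφ : Measurable φ) {B : ℝ≥0∞}
    (hB : ∀ x, 0 ≤ x → killedGreen P X (fun y => φ y * renewalFn P (walk X) y) x ≤
      B * renewalFn P (walk X) x)
    (n : ℕ) {g : (Fin (n + 1) → ℝ) → ℝ≥0∞} (hg : Measurable g) :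
    ∫⁻ ω', g (fun i => ζ i ω') * (∑' m, φ (ζ (n + m) ω')) ^ 2 ∂P' ≤
      2 * B ^ 2 * ∫⁻ ω', g (fun i => ζ i ω') ∂P' := by
  have hζm := hζ.measurable
  have hφζ (k : ℕ) : Measurable fun ω' => φ (ζ k ω') := hφ.comp (hζm k)
  have hgζ : Measurable fun ω' => g (fun i => ζ i ω') := hg.comp (by fun_prop)
  have hm (i j : ℕ) : Measurable fun ω' =>
      g (fun i => ζ i ω') * φ (ζ (n + i) ω') * φ (ζ (n + i + j) ω') :=
    (hgζ.mul (hφζ _)).mul (hφζ _)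
  calc _ ≤ ∫⁻ ω', 2 * ∑' i, ∑' j,
        g (fun i => ζ i ω') * φ (ζ (n + i) ω') * φ (ζ (n + i + j) ω') ∂P' := by
        refine lintegral_mono fun ω' => ?_
        simp only
        calc _ ≤ g (fun i => ζ i ω') *
              (2 * ∑' i, ∑' j, φ (ζ (n + i) ω') * φ (ζ (n + (i + j)) ω')) := by
              gcongr
              exact sq_tsum_le fun m => φ (ζ (n + m) ω')
          _ = _ := by
              simp_rw [mul_assoc, ENNReal.tsum_mul_left, ← add_assoc]
              ring
    _ = 2 * ∑' i, ∑' j, ∫⁻ ω',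
        g (fun i => ζ i ω') * φ (ζ (n + i) ω') * φ (ζ (n + i + j) ω') ∂P' := by
        rw [lintegral_const_mul _ (Measurable.tsum fun i => Measurable.tsum fun j => hm i j),
          lintegral_tsum fun i => (Measurable.tsum fun j => hm i j).aemeasurable]
        congr 1
        exact tsum_congr fun i => lintegral_tsum fun j => (hm i j).aemeasurable
    -- The Markov bound at time `n + i`, with `g · φ(ζ (n + i))` as functional of the past; the next
    -- line applies it once more at time `n`.
    _ ≤ 2 * ∑' i, B * ∫⁻ ω', g (fun i => ζ i ω') * φ (ζ (n + i) ω') ∂P' := by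
        gcongr with i
        have hg' : Measurable fun y : Fin (n + i + 1) → ℝ =>
            g (fun k => y (Fin.castLE (by omega) k)) * φ (y (Fin.last _)) :=
          (hg.comp (by fun_prop)).mul (hφ.comp (by fun_prop))
        have := hζ.tsum_lintegral_le h hφ hB (n + i) hg'
        simpa only [Fin.val_castLE, Fin.val_last] using this
    _ ≤ 2 * (B * (B * ∫⁻ ω', g (fun i => ζ i ω') ∂P')) := by
        rw [ENNReal.tsum_mul_left]
        gcongr
        exact hζ.tsum_lintegral_le h hφ hB n hg
    _ = _ := by ring

/-- Given an event of the past on which `ζ n ≤ L`, an additive functional that charges only heights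
above `L` is at least of the order of its mean with probability bounded below. -/
lemma le_measure_shell (hζ : IsConditionedToStayPositive P (walk X) P' ζ)
    (h : IsIIDSteps P X) [IsProbabilityMeasure P] [IsProbabilityMeasure P']
    (hG : GreenBounds P X K c C) {n : ℕ} {G : Set (Fin (n + 1) → ℝ)} (hGm : MeasurableSet G)
    {L : ℝ} (hGL : ∀ y ∈ G, y (Fin.last n) ≤ L) {w : ℕ → ℝ≥0∞} (hw : ∀ i, K ^ i < L → w i = 0)
    {I : ℝ} (hI : 0 < I) (hwI : ∑' i, w i * ENNReal.ofReal ((K ^ i) ^ 2) = ENNReal.ofReal I) :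
    ENNReal.ofReal (c ^ 2 / (8 * (C * K ^ 2) ^ 2)) * P' {ω' | (fun i : Fin (n + 1) => ζ i ω') ∈ G} ≤
      P' ({ω' | (fun i : Fin (n + 1) => ζ i ω') ∈ G} ∩
        {ω' | ENNReal.ofReal (c * I / 2) ≤ ∑' m, shellFn K w (ζ (n + m) ω')}) := by
  have hζm := hζ.measurable
  have hφ := measurable_shellFn K w
  have hK := hG.one_lt
  have hc := hG.c_pos
  have hC := hG.C_pos
  set D := {ω' | (fun i : Fin (n + 1) => ζ i ω') ∈ G}
  have hvec : Measurable fun ω' => fun i : Fin (n + 1) => ζ i ω' := by fun_prop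
  have hD : MeasurableSet D := hvec hGm
  have hg : Measurable (G.indicator (1 : (Fin (n + 1) → ℝ) → ℝ≥0∞)) := measurable_one.indicator hGm
  have hgD (ω' : Ω') : G.indicator (1 : (Fin (n + 1) → ℝ) → ℝ≥0∞) (fun i : Fin (n + 1) => ζ i ω') =
      D.indicator 1 ω' := rfl
  have hset (f : Ω' → ℝ≥0∞) : ∫⁻ ω', D.indicator 1 ω' * f ω' ∂P' = ∫⁻ ω' in D, f ω' ∂P' := by
    rw [← lintegral_indicator hD]
    refine lintegral_congr fun ω' => ?_
    by_cases hω : ω' ∈ D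
    · rw [indicator_of_mem hω, indicator_of_mem hω, Pi.one_apply, one_mul]
    · rw [indicator_of_notMem hω, indicator_of_notMem hω, zero_mul]
  have hφm (m : ℕ) : Measurable fun ω' => shellFn K w (ζ (n + m) ω') := hφ.comp (hζm _)
  have hAm : Measurable fun ω' => ∑' m, shellFn K w (ζ (n + m) ω') := Measurable.tsum hφm
  have hmean : ENNReal.ofReal (c * I) * P' D ≤
      ∫⁻ ω' in D, ∑' m, shellFn K w (ζ (n + m) ω') ∂P' := by
    have := hζ.le_tsum_lintegral h hφ (B := ENNReal.ofReal c * ENNReal.ofReal I) (L := L)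
      (fun x hx hxL => by simpa only [hwI] using hG.le_killedGreen_shellFn h hw hx hxL) n hg
      (fun y hy => hGL y (by by_contra hyG; exact hy (indicator_of_notMem hyG _)))
    simp only [hgD, hset, lintegral_indicator_one hD] at this
    rw [ENNReal.ofReal_mul hc.le, lintegral_tsum fun m => (hφm m).aemeasurable]
    exact this
  have hsq : ∫⁻ ω' in D, (∑' m, shellFn K w (ζ (n + m) ω')) ^ 2 ∂P' ≤
      ENNReal.ofReal (2 * (C * K ^ 2 * I) ^ 2) * P' D := by
    have := hζ.lintegral_sq_tsum_le h hφ (B := ENNReal.ofReal (C * K ^ 2) * ENNReal.ofReal I)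
      (fun x hx => by simpa only [hwI] using hG.killedGreen_shellFn_le h w hx) n hg
    simp only [hgD, hset, lintegral_indicator_one hD] at this
    rwa [← ENNReal.ofReal_mul (by positivity), ← ENNReal.ofReal_pow (by positivity),
      ← ENNReal.ofReal_ofNat, ← ENNReal.ofReal_mul (by positivity)] at this
  -- In `b² / (4V)` the factor `I` cancels, so the resulting constant depends only on the Green
  -- bounds.
  have hpz := paley_zygmund (P'.restrict D) hAm (b := c * I) (V := 2 * (C * K ^ 2 * I) ^ 2)
    (by positivity) (by positivity) (by simpa using hmean) (by simpa using hsq)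
  rw [Measure.restrict_apply_univ, Measure.restrict_apply (measurableSet_le measurable_const hAm),
    inter_comm] at hpz
  refine le_trans (le_of_eq ?_) hpz
  congr 2
  field_simp
  norm_num

/-- Divergence of the mean forces divergence with conditional probability bounded below. -/
lemma le_measure_tsum_eq_top (hζ : IsConditionedToStayPositive P (walk X) P' ζ)
    (h : IsIIDSteps P X) [IsProbabilityMeasure P] [IsProbabilityMeasure P']
    (hG : GreenBounds P X K c C) {F : ℝ → ℝ} (hF : Antitone F)
    (hJ : ∑' i : ℕ, ENNReal.ofReal (F (K ^ (i + 1))) * ENNReal.ofReal ((K ^ i) ^ 2) = ∞)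
    {n : ℕ} {G : Set (Fin (n + 1) → ℝ)} (hGm : MeasurableSet G) :
    ENNReal.ofReal (c ^ 2 / (8 * (C * K ^ 2) ^ 2)) * P' {ω' | (fun i : Fin (n + 1) => ζ i ω') ∈ G} ≤
      P' ({ω' | (fun i : Fin (n + 1) => ζ i ω') ∈ G} ∩
        {ω' | ∑' m, ENNReal.ofReal (F (ζ m ω')) = ∞}) := by
  have hζm := hζ.measurable
  have hK := hG.one_lt
  have hc := hG.c_pos
  have hvec : Measurable fun ω' => fun i : Fin (n + 1) => ζ i ω' := by fun_prop
  have hAm : Measurable fun ω' => ∑' m, ENNReal.ofReal (F (ζ m ω')) :=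
    Measurable.tsum fun m => ENNReal.measurable_ofReal.comp (hF.measurable.comp (hζm m))
  set κ := ENNReal.ofReal (c ^ 2 / (8 * (C * K ^ 2) ^ 2))
  set f : ℕ → ℝ≥0∞ := fun i => ENNReal.ofReal (F (K ^ (i + 1))) * ENNReal.ofReal ((K ^ i) ^ 2)
    with hf
  have hfin (i : ℕ) : f i ≠ ∞ := ENNReal.mul_ne_top ENNReal.ofReal_ne_top ENNReal.ofReal_ne_top
  have hbdd (G : Set (Fin (n + 1) → ℝ)) (hGm : MeasurableSet G) (L : ℝ)
      (hGL : ∀ y ∈ G, y (Fin.last n) ≤ L) (M : ℕ) :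
      κ * P' {ω' | (fun i : Fin (n + 1) => ζ i ω') ∈ G} ≤
        P' ({ω' | (fun i : Fin (n + 1) => ζ i ω') ∈ G} ∩
          {ω' | (M : ℝ≥0∞) ≤ ∑' m, ENNReal.ofReal (F (ζ m ω'))}) := by
    obtain ⟨i₀, hi₀⟩ := pow_unbounded_of_one_lt L hK
    have htail : ∑' i, f (i + i₀) = ∞ := by
      have := ENNReal.summable.sum_add_tsum_nat_add' (f := f) (k := i₀)
      rw [hJ] at this
      exact (ENNReal.add_eq_top.1 this).resolve_left (ENNReal.sum_ne_top.2 fun i _ => hfin i)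
    -- A finite window of shells above `L`, heavy enough that half the mean lower bound, `c * I /
    -- 2`, exceeds `M`; finiteness of the window keeps `I` finite.
    obtain ⟨N, hN⟩ : ∃ N, ENNReal.ofReal (2 * (M + 1) / c) < ∑ i ∈ Finset.range N, f (i + i₀) := by
      rw [ENNReal.tsum_eq_iSup_nat] at htail
      exact lt_iSup_iff.1 (htail ▸ ENNReal.ofReal_lt_top)
    set w : ℕ → ℝ≥0∞ := fun i =>
      if i₀ ≤ i ∧ i < i₀ + N then ENNReal.ofReal (F (K ^ (i + 1))) else 0 with hw
    have hsum : ∑' i, w i * ENNReal.ofReal ((K ^ i) ^ 2) = ∑ i ∈ Finset.range N, f (i + i₀) := by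
      rw [tsum_eq_sum (s := Finset.Ico i₀ (i₀ + N)), Finset.sum_Ico_eq_sum_range,
        Nat.add_sub_cancel_left]
      · refine Finset.sum_congr rfl fun i hi => ?_
        have : i < N := by simpa using hi
        simp only [hw, hf, show i₀ ≤ i₀ + i ∧ i₀ + i < i₀ + N by omega, and_self, if_true,
          add_comm i i₀]
      · intro i hi
        have : ¬ (i₀ ≤ i ∧ i < i₀ + N) := by simpa using hi
        simp only [hw, if_neg this, zero_mul]
    set I := (∑ i ∈ Finset.range N, f (i + i₀)).toReal with hI
    have hIe : ∑ i ∈ Finset.range N, f (i + i₀) = ENNReal.ofReal I :=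
      (ENNReal.ofReal_toReal (ENNReal.sum_ne_top.2 fun i _ => hfin _)).symm
    have hMI : 2 * (M + 1) / c < I := by
      rw [hIe] at hN
      exact (ENNReal.ofReal_lt_ofReal_iff_of_nonneg (by positivity)).1 hN
    have hI0 : 0 < I := lt_of_le_of_lt (by positivity) hMI
    have hwL (i : ℕ) (hi : K ^ i < L) : w i = 0 := by
      have : i < i₀ := (pow_lt_pow_iff_right₀ hK).1 (hi.trans hi₀)
      simp only [hw]
      rw [if_neg (by omega)]
    refine (hζ.le_measure_shell h hG hGm hGL hwL hI0 (hsum.trans hIe)).trans ?_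
    refine measure_mono (inter_subset_inter_right _ fun ω' hω' => ?_)
    simp only [mem_ofPred_eq] at hω' ⊢
    have h1 : (M : ℝ≥0∞) ≤ ENNReal.ofReal (c * I / 2) := by
      rw [← ENNReal.ofReal_natCast]
      apply ENNReal.ofReal_le_ofReal
      rw [div_lt_iff₀ hc] at hMI
      linarith
    refine h1.trans (hω'.trans ?_)
    calc ∑' m, shellFn K w (ζ (n + m) ω') ≤ ∑' m, ENNReal.ofReal (F (ζ (n + m) ω')) := by
          refine ENNReal.tsum_le_tsum fun m => shellFn_le hK fun i _ h2 => ?_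
          simp only [hw]
          split_ifs
          · exact ENNReal.ofReal_le_ofReal (hF h2.le)
          · exact zero_le
      _ ≤ _ := ENNReal.tsum_comp_le_tsum_of_injective (add_right_injective n)
          fun m => ENNReal.ofReal (F (ζ m ω'))
  -- Since `κ` depends on neither `M` nor `L`, let `M → ∞` here and then `L → ∞` to lift the
  -- restriction `ζ n ≤ L`.
  have htop (G : Set (Fin (n + 1) → ℝ)) (hGm : MeasurableSet G) (L : ℝ)
      (hGL : ∀ y ∈ G, y (Fin.last n) ≤ L) :
      κ * P' {ω' | (fun i : Fin (n + 1) => ζ i ω') ∈ G} ≤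
        P' ({ω' | (fun i : Fin (n + 1) => ζ i ω') ∈ G} ∩
          {ω' | ∑' m, ENNReal.ofReal (F (ζ m ω')) = ∞}) := by
    have hset : {ω' | (fun i : Fin (n + 1) => ζ i ω') ∈ G} ∩
          {ω' | ∑' m, ENNReal.ofReal (F (ζ m ω')) = ∞} =
        ⋂ M : ℕ, {ω' | (fun i : Fin (n + 1) => ζ i ω') ∈ G} ∩
          {ω' | (M : ℝ≥0∞) ≤ ∑' m, ENNReal.ofReal (F (ζ m ω'))} := by
      rw [← inter_iInter]
      congr 1
      ext ω'
      simp only [mem_ofPred_eq, mem_iInter]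
      refine ⟨fun h _ => h ▸ le_top, fun h => ?_⟩
      by_contra hne
      obtain ⟨M, hM⟩ := ENNReal.exists_nat_gt hne
      exact absurd (h M) (not_le.2 hM)
    rw [hset]
    refine ge_of_tendsto' (tendsto_measure_iInter_atTop (μ := P') (fun M =>
      ((hvec hGm).inter (measurableSet_le measurable_const hAm)).nullMeasurableSet) ?_
      ⟨0, measure_ne_top _ _⟩) fun M => hbdd G hGm L hGL M
    intro M M' hMM ω' hω'
    have h1 : (M' : ℝ≥0∞) ≤ ∑' m, ENNReal.ofReal (F (ζ m ω')) := hω'.2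
    exact ⟨hω'.1, le_trans (Nat.cast_le.2 hMM) h1⟩
  have hUn : {ω' | (fun i : Fin (n + 1) => ζ i ω') ∈ G} =
      ⋃ L : ℕ, {ω' | (fun i : Fin (n + 1) => ζ i ω') ∈ G ∩ {y | y (Fin.last n) ≤ L}} := by
    ext ω'
    simp only [mem_ofPred_eq, mem_iUnion, mem_inter_iff, exists_and_left]
    exact ⟨fun h => ⟨h, exists_nat_ge _⟩, fun h => h.1⟩
  have hlim := tendsto_measure_iUnion_atTop (μ := P')
    (s := fun L : ℕ => {ω' | (fun i : Fin (n + 1) => ζ i ω') ∈ G ∩ {y | y (Fin.last n) ≤ L}})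
    (by
      intro L L' hL ω' hω'
      have h1 : ζ (Fin.last n) ω' ≤ (L : ℝ) := hω'.2
      exact ⟨hω'.1, h1.trans (Nat.cast_le.2 hL)⟩)
  rw [← hUn] at hlim
  refine le_of_tendsto' (ENNReal.Tendsto.const_mul hlim (.inr ENNReal.ofReal_ne_top)) fun L => ?_
  have hLm : MeasurableSet {y : Fin (n + 1) → ℝ | y (Fin.last n) ≤ L} :=
    measurableSet_le (by fun_prop) measurable_const
  refine (htop _ (hGm.inter hLm) L fun y hy => hy.2).trans
    (measure_mono (inter_subset_inter_left _ fun ω' hω' => hω'.1))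

lemma ae_tsum_eq_top (hζ : IsConditionedToStayPositive P (walk X) P' ζ)
    (h : IsIIDSteps P X) [IsProbabilityMeasure P] [IsProbabilityMeasure P']
    (hG : GreenBounds P X K c C) {F : ℝ → ℝ} (hF : Antitone F)
    (hJ : ∑' i : ℕ, ENNReal.ofReal (F (K ^ (i + 1))) * ENNReal.ofReal ((K ^ i) ^ 2) = ∞) :
    ∀ᵐ ω' ∂P', ∑' m, ENNReal.ofReal (F (ζ m ω')) = ∞ := by
  have hζm := hζ.measurable
  have hK := hG.one_lt
  have hc := hG.c_pos
  have hC := hG.C_pos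
  have hpath : Measurable fun ω' k => ζ k ω' := by fun_prop
  set E : Set (ℕ → ℝ) := {v | ∑' m, ENNReal.ofReal (F (v m)) = ∞}
  have hE : MeasurableSet E := by
    have : Measurable fun v : ℕ → ℝ => ∑' m, ENNReal.ofReal (F (v m)) :=
      Measurable.tsum fun m => ENNReal.measurable_ofReal.comp (hF.measurable.comp (by fun_prop))
    exact this (measurableSet_singleton ∞)
  have : IsProbabilityMeasure (P'.map fun ω' k => ζ k ω') :=
    Measure.isProbabilityMeasure_map hpath.aemeasurable
  have h0 := measure_compl_eq_zero_of_cylinders (P'.map fun ω' k => ζ k ω') hE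
    (κ := ENNReal.ofReal (c ^ 2 / (8 * (C * K ^ 2) ^ 2)))
    (by simp only [ne_eq, ENNReal.ofReal_eq_zero, not_le]; positivity) ENNReal.ofReal_ne_top ?_
  · rw [Measure.map_apply hpath hE.compl] at h0
    exact h0
  · intro D hD
    obtain ⟨s, S, hS, rfl⟩ := (mem_measurableCylinders D).1 hD
    have hcm := MeasurableSet.of_mem_measurableCylinders hD
    rw [Measure.map_apply hpath hcm, Measure.map_apply hpath (hcm.inter hE)]
    -- A cylinder over the finite set `s` is an event of the past up to the time `s.sup id`.
    have hs (i : s) : (i : ℕ) < s.sup id + 1 := Nat.lt_succ_of_le (Finset.le_sup (f := id) i.2)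
    have hGm : MeasurableSet
        ((fun (y : Fin (s.sup id + 1) → ℝ) (i : s) => y ⟨i, hs i⟩) ⁻¹' S) :=
      hS.preimage (by fun_prop)
    exact hζ.le_measure_tsum_eq_top h hG hF hJ hGm

/-- Heights below `1` lie in no shell; they contribute at most `F 0` times the finite mean time
spent there. -/
lemma lintegral_tsum_ne_top (hζ : IsConditionedToStayPositive P (walk X) P' ζ)
    (h : IsIIDSteps P X) [IsProbabilityMeasure P] [IsProbabilityMeasure P']
    (hG : GreenBounds P X K c C) {F : ℝ → ℝ} (hF : Antitone F)
    (hJ : ∑' i : ℕ, ENNReal.ofReal (F (K ^ (i + 1))) * ENNReal.ofReal ((K ^ i) ^ 2) ≠ ∞) :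
    ∫⁻ ω', ∑' m, ENNReal.ofReal (F (ζ m ω')) ∂P' ≠ ∞ := by
  have hζm := hζ.measurable
  have hK := hG.one_lt
  set w : ℕ → ℝ≥0∞ := fun i => ENNReal.ofReal (F (K ^ i)) with hw
  have hI : Measurable ((Iio (1 : ℝ)).indicator (1 : ℝ → ℝ≥0∞)) :=
    measurable_one.indicator measurableSet_Iio
  have hφ := measurable_shellFn K w
  have h1 : ∑' m, ∫⁻ ω', (Iio (1 : ℝ)).indicator 1 (ζ m ω') ∂P' ≤ ENNReal.ofReal (C * 1 ^ 2) := by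
    have := hζ.tsum_lintegral_le h hI (B := ENNReal.ofReal (C * 1 ^ 2)) (fun x hx => by
      refine le_trans (le_of_eq ?_) (hG.upper 1 x le_rfl hx)
      congr 1
      funext y
      by_cases hy : y ∈ Iio (1 : ℝ) <;> simp [indicator, hy]) 0 (g := fun _ => 1) measurable_const
    simpa using this
  have h2 : ∑' m, ∫⁻ ω', shellFn K w (ζ m ω') ∂P' ≤
      ENNReal.ofReal (C * K ^ 2) * ∑' i, w i * ENNReal.ofReal ((K ^ i) ^ 2) := by
    have := hζ.tsum_lintegral_le h hφ (fun x hx => hG.killedGreen_shellFn_le h w hx) 0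
      (g := fun _ => 1) measurable_const
    simpa using this
  have hle : ∫⁻ ω', ∑' m, ENNReal.ofReal (F (ζ m ω')) ∂P' ≤
      ∑' m, (ENNReal.ofReal (F 0) * ∫⁻ ω', (Iio (1 : ℝ)).indicator 1 (ζ m ω') ∂P' +
        ∫⁻ ω', shellFn K w (ζ m ω') ∂P') := by
    have hFm (m : ℕ) : Measurable fun ω' => ENNReal.ofReal (F (ζ m ω')) :=
      ENNReal.measurable_ofReal.comp (hF.measurable.comp (hζm m))
    rw [lintegral_tsum fun m => (hFm m).aemeasurable]
    refine ENNReal.tsum_le_tsum fun m => ?_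
    have hIm : Measurable fun ω' => (Iio (1 : ℝ)).indicator (1 : ℝ → ℝ≥0∞) (ζ m ω') :=
      hI.comp (hζm m)
    rw [← lintegral_const_mul _ hIm, ← lintegral_add_left (hIm.const_mul _)]
    refine lintegral_mono_ae ?_
    filter_upwards [hζ.ae_nonneg h m] with ω' hω'
    exact le_indicator_add_shellFn hK (f := fun y => ENNReal.ofReal (F y))
      (fun y h0 _ => ENNReal.ofReal_le_ofReal (hF h0))
      (fun i y h1 _ => ENNReal.ofReal_le_ofReal (hF h1)) hω'
  refine ne_top_of_le_ne_top ?_ hle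
  rw [ENNReal.tsum_add, ENNReal.tsum_mul_left]
  refine ENNReal.add_ne_top.2 ⟨ENNReal.mul_ne_top ENNReal.ofReal_ne_top
    (ne_top_of_le_ne_top ENNReal.ofReal_ne_top h1), ne_top_of_le_ne_top ?_ h2⟩
  rw [hw, tsum_shell_eq hK]
  exact ENNReal.mul_ne_top ENNReal.ofReal_ne_top (ENNReal.add_ne_top.2
    ⟨ENNReal.ofReal_ne_top, ENNReal.mul_ne_top ENNReal.ofReal_ne_top hJ⟩)

end IsConditionedToStayPositive

end ConditionedWalk

end

theorem proposition2p6 {Ω Ω' : Type*} [MeasurableSpace Ω] [MeasurableSpace Ω']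
    (P : Measure Ω) [IsProbabilityMeasure P] (P' : Measure Ω') [IsProbabilityMeasure P']
    (X : ℕ → Ω → ℝ) (hXm : ∀ n, Measurable (X n))
    (hXindep : iIndepFun X P) (hXident : ∀ n, IdentDistrib (X n) (X 0) P P)
    (hXL2 : MemLp (X 0) 2 P) (hXmean : ∫ ω, X 0 ω ∂P = 0)
    (hXvar : 0 < variance (X 0) P)
    (ζ : ℕ → Ω' → ℝ)
    (hζ : ConditionedWalk.IsConditionedToStayPositive P (ConditionedWalk.walk X) P' ζ)
    (F : ℝ → ℝ) (hFnonneg : ∀ y, 0 ≤ y → 0 ≤ F y) (hFanti : AntitoneOn F (Ici 0)) :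
    (∫⁻ y in Ici (0 : ℝ), ENNReal.ofReal (F y * y)) = ∞ ↔
      ∀ᵐ ω' ∂P', ∑' n : ℕ, ENNReal.ofReal (F (ζ n ω')) = ∞ := by
  have h : ConditionedWalk.IsIIDSteps P X := ⟨hXm, hXindep, hXident⟩
  obtain ⟨K, c, C, hG⟩ := h.exists_greenBounds hXL2 hXmean hXvar
  -- `F` is controlled only on `[0, ∞)`; composing with `max · 0` makes it antitone on `ℝ` and
  -- changes neither side, as `ζ ≥ 0` almost surely.
  have hF' : Antitone fun y => F (max y 0) := fun x y hxy =>
    hFanti (le_max_right x 0) (le_max_right y 0) (max_le_max_right 0 hxy)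
  have hint : ∫⁻ y in Ici (0 : ℝ), ENNReal.ofReal (F y * y) =
      ∫⁻ y in Ici (0 : ℝ), ENNReal.ofReal (F (max y 0) * y) :=
    setLIntegral_congr_fun measurableSet_Ici fun y hy => by
      rw [max_eq_left (show (0 : ℝ) ≤ y from hy)]
  have hsum : ∀ᵐ ω' ∂P', ∑' n : ℕ, ENNReal.ofReal (F (ζ n ω')) =
      ∑' n : ℕ, ENNReal.ofReal (F (max (ζ n ω') 0)) := by
    filter_upwards [ae_all_iff.2 (hζ.ae_nonneg h)] with ω' hω'
    exact tsum_congr fun n => by rw [max_eq_left (hω' n)]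
  rw [hint, ConditionedWalk.setLIntegral_eq_top_iff hG.one_lt
    (fun y => hFnonneg _ (le_max_right y 0)) hF']
  constructor
  · intro hJ
    filter_upwards [hsum, hζ.ae_tsum_eq_top h hG hF' hJ] with ω' h1 h2
    rw [h1, h2]
  · intro htop
    by_contra hJ
    refine hζ.lintegral_tsum_ne_top h hG hF' hJ ?_
    have : ∀ᵐ ω' ∂P', ∑' n : ℕ, ENNReal.ofReal (F (max (ζ n ω') 0)) = ∞ := by
      filter_upwards [hsum, htop] with ω' h1 h2
      rw [← h1, h2]
    rw [lintegral_congr_ae this]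
    simp
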